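/- **Setting.** Let $p\in[1,2]$, $1/p+1/q=1$ (so $q\in[2,\infty]$), and let $Q\subset\mathbb R^n$ be a nonempty compact convex set. Let $f(x)=\mathbb E_\xi[f(x,\xi)]$ be finite and convex on $Q$. Let $\nabla_x f(x,\xi)\in\mathbb R^n$ be a stochastic subgradient, jointly measurable in $(x,\xi)$ and unbiased: for every $x\in Q$ the expectation $\mathbb E_\xi[\nabla_x f(x,\xi)]$ exists and is a subgradient of $f$ at $x$ relative to $Q$. Let $d$ be a prox-function on $Q$ with starting point $x^0\in Q$: $d$ is continuous on $Q$, $d\ge 0$, $d(x^0)=0$, $d$ is $1$-strongly convex on $Q$ in the norm $\|\cdot\|_p$, and $d$ is differentiable (relative to $Q$) at every point of $Q$ at which it has a subgradient relative to $Q$. Put $$V(x,y)=d(x)-d(y)-\langle\nabla d(y),x-y\rangle,\qquad \mathrm{Mirr}_y(v)=\arg\min_{x\in Q}\{\langle v,x-y\rangle+V(x,y)\}.$$ Let $x_*$ be a minimizer of $f$ on $Q$, $f_*=f(x_*)=\min_Q f$, $R=\sqrt{V(x_*,x^0)}$ and $\bar R=\max_{x,y\in Q}\|x-y\|_p$. Let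 $\xi^0,\xi^1,\dots$ be independent copies of $\xi$, let $M>0$, and let $N\ge1$ be an integer. Stochastic mirror descent is $$x^{k+1}=\mathrm{Mirr}_{x^k}\bigl(h\,\nabla_x f(x^k,\xi^k)\bigr),\quad k=0,\dots,N-1,\qquad h=\frac RM\sqrt{\frac 2N},\qquad \bar x^N=\frac1N\sum_{k=0}^{N-1}x^k .$$ **Theorem.** There exist absolute constants $C_1,C_2\in(0,3]$ and, for every $\alpha>2$, a constant $C_1(\alpha)>0$ depending only on $\alpha$, such that in every setting as above and for every $\sigma\in(0,1)$ the following holds. Assume one of the conditions i) $\|\nabla_x f(x,\xi)\|_q\le M$ for every $x\in Q$ and almost every $\xi$; ii) $\mathbb E_\xi\bigl[\exp(\|\nabla_x f(x,\xi)\|_q^2/M^2)\bigr]\le e$ for every $x\in Q$, and $\ln\sigma^{-1}\le N$; iii) for some $\alpha>2$, $\mathbb P\bigl(\|\nabla_x f(x,\xi)\|_q^2/M^2\ge t\bigr)\le(1+t)^{-\alpha}$ for every $x\in Q$ and $t\ge0$, and $\sigma^{-1/(\alpha-1)}\le N$. Then $$\mathbb P\left(f(\bar x^N)-f_*\le\frac{C_1M}{\sqrt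 N}\Bigl(R+C_2\bar R\sqrt{\ln\sigma^{-1}}\Bigr)\right)\ge1-\sigma,$$ where in case iii) $C_1$ is replaced by $C_1(\alpha)$. -/

import Mathlib

open MeasureTheory ProbabilityTheory
open scoped ENNReal

noncomputable section

namespace MirrorDescent

/-- `ℝⁿ` with the norm `‖·‖_p`. -/
abbrev Vec (p : ℝ≥0∞) (n : ℕ) : Type := PiLp p (fun _ : Fin n => ℝ)

/-- The pairing `⟨v, x⟩ = ∑ i, v i * x i` of a (sub)gradient `v`, measured in `‖·‖_q`, and a point
`x`, measured in `‖·‖_p`. -/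
def pairing {p q : ℝ≥0∞} {n : ℕ} (v : Vec q n) (x : Vec p n) : ℝ := ∑ i, v i * x i

section Prox

variable {p : ℝ≥0∞} [Fact (1 ≤ p)] {n : ℕ}

/-- The Bregman divergence `V(x, y) = d(x) - d(y) - ⟨∇d(y), x - y⟩` on the convex set `Q`.
The derivative of `d` is taken relative to `Q`, so only the values of `d` on `Q` matter; it may be
non-unique when `Q` has empty interior, but its values on the vectors `x - y` with `x ∈ Q` are
unique whenever `d` is differentiable at `y` relative to `Q`. -/
def bregman (Q : Set (Vec p n)) (d : Vec p n → ℝ) (x y : Vec p n) : ℝ :=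
  d x - d y - fderivWithin ℝ d Q y (x - y)

/-- `d` is a prox-function on `Q` with starting point `x₀`: it is continuous, nonnegative, vanishes
at `x₀`, is `1`-strongly convex in the `p`-norm, and has a gradient wherever it has a subgradient.
The last clause holds if `d` is differentiable on all of `Q`; it also holds for the entropy
`log n + ∑ x_k log x_k` on the simplex, which has no subgradient at the boundary points. -/
structure IsProxFunction (Q : Set (Vec p n)) (d : Vec p n → ℝ) (x₀ : Vec p n) : Prop where
  start_mem : x₀ ∈ Q
  start_eq_zero : d x₀ = 0
  nonneg : ∀ x ∈ Q, 0 ≤ d x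
  continuousOn : ContinuousOn d Q
  strongConvexOn : StrongConvexOn Q 1 d
  differentiable : ∀ y ∈ Q, (∃ s : Vec p n →L[ℝ] ℝ, ∀ x ∈ Q, d y + s (x - y) ≤ d x) →
    DifferentiableWithinAt ℝ d Q y

open Classical in
/-- `Mirr_y(v) = argmin_{x ∈ Q} {⟨v, x - y⟩ + V(x, y)}` (and `y` if there is no minimizer; for
compact `Q` and a prox-function `d` there is exactly one). -/
def mirr {q : ℝ≥0∞} (Q : Set (Vec p n)) (d : Vec p n → ℝ) (y : Vec p n) (v : Vec q n) : Vec p n :=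
  if h : ∃ z ∈ Q, IsMinOn (fun x => pairing v (x - y) + bregman Q d x y) Q z then h.choose else y

/-- The iterates of stochastic mirror descent with stochastic gradient oracle `G`, constant step
`h` and samples `s 0, s 1, …`: `x^0 = x₀`, `x^{k+1} = Mirr_{x^k}(h • G(x^k, s k))`. -/
def iterate {q : ℝ≥0∞} {Ξ : Type*} (Q : Set (Vec p n)) (d : Vec p n → ℝ) (x₀ : Vec p n)
    (G : Vec p n → Ξ → Vec q n) (h : ℝ) (s : ℕ → Ξ) : ℕ → Vec p n
  | 0 => x₀
  | k + 1 => mirr Q d (iterate Q d x₀ G h s k) (h • G (iterate Q d x₀ G h s k) (s k))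

/-- The average `(x^0 + ⋯ + x^{N-1}) / N`. -/
def average (x : ℕ → Vec p n) (N : ℕ) : Vec p n := (N : ℝ)⁻¹ • ∑ k ∈ Finset.range N, x k

/-- `R = √V(x_*, x₀)`. -/
def proxRadius (Q : Set (Vec p n)) (d : Vec p n → ℝ) (xs x₀ : Vec p n) : ℝ :=
  √(bregman Q d xs x₀)

/-- `R̄ = max_{x, y ∈ Q} ‖x - y‖_p` (the supremum, attained for nonempty compact `Q`). -/
def setDiam (Q : Set (Vec p n)) : ℝ := sSup {r | ∃ x ∈ Q, ∃ y ∈ Q, r = ‖x - y‖}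

end Prox

section Problem

variable {p q : ℝ≥0∞} [Fact (1 ≤ p)] [Fact (1 ≤ q)] {n : ℕ} {Ξ : Type*} [MeasurableSpace Ξ]

/-- The objective `f(x) = E_ξ[F(x, ξ)]`, where `ξ` has law `P`. -/
def objective (P : Measure Ξ) (F : Vec p n → Ξ → ℝ) (x : Vec p n) : ℝ := ∫ s, F x s ∂P

/-- A stochastic convex program on `Q` with an unbiased stochastic subgradient oracle `G`: the
objective `f(x) = E_ξ[F(x, ξ)]` is finite and convex on the compact convex set `Q`, `G` is jointly
measurable, and for each `x ∈ Q` the mean `E_ξ[G(x, ξ)]` exists and is a subgradient of `f` at `x`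
relative to `Q`. Nothing else is required of `G`; in particular a measurable selection of the
subdifferentials of the functions `F(·, ξ)` with this property is allowed. -/
structure IsStochasticProgram (Q : Set (Vec p n)) (P : Measure Ξ) (F : Vec p n → Ξ → ℝ)
    (G : Vec p n → Ξ → Vec q n) : Prop where
  isCompact : IsCompact Q
  convex : Convex ℝ Q
  integrable_value : ∀ x ∈ Q, Integrable (F x) P
  convexOn : ConvexOn ℝ Q (objective P F)
  measurable_grad : Measurable (Function.uncurry G)
  integrable_grad : ∀ x ∈ Q, Integrable (G x) P
  unbiased : ∀ x ∈ Q, ∀ y ∈ Q,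
    objective P F x + pairing (∫ s, G x s ∂P) (y - x) ≤ objective P F y

/-- i) `‖G(x, ξ)‖_q ≤ M` for all `x ∈ Q`, almost surely in `ξ`. -/
def BoundedGrad (Q : Set (Vec p n)) (P : Measure Ξ) (G : Vec p n → Ξ → Vec q n) (M : ℝ) : Prop :=
  ∀ x ∈ Q, ∀ᵐ s ∂P, ‖G x s‖ ≤ M

/-- ii) `E_ξ[exp(‖G(x, ξ)‖_q² / M²)] ≤ exp 1` for all `x ∈ Q`. -/
def SubGaussianGrad (Q : Set (Vec p n)) (P : Measure Ξ) (G : Vec p n → Ξ → Vec q n)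
    (M : ℝ) : Prop :=
  ∀ x ∈ Q, ∫⁻ s, ENNReal.ofReal (Real.exp (‖G x s‖ ^ 2 / M ^ 2)) ∂P ≤ ENNReal.ofReal (Real.exp 1)

/-- iii) `P(‖G(x, ξ)‖_q² / M² ≥ t) ≤ (1 + t)^(-α)` for all `x ∈ Q` and `t ≥ 0`. -/
def PolynomialTailGrad (Q : Set (Vec p n)) (P : Measure Ξ) (G : Vec p n → Ξ → Vec q n)
    (M α : ℝ) : Prop :=
  ∀ x ∈ Q, ∀ t : ℝ, 0 ≤ t →
    P {s | t ≤ ‖G x s‖ ^ 2 / M ^ 2} ≤ ENNReal.ofReal ((1 + t) ^ (-α))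

/-- The step `h = (R / M) √(2 / N)`. -/
def stepSize (R M : ℝ) (N : ℕ) : ℝ := R / M * √(2 / N)

/-- The bound
`Pr(f(x̄^N) - f(x_*) ≤ C₁ M / √N * (R + C₂ R̄ √(log σ⁻¹))) ≥ 1 - σ`
for the average of the first `N` iterates run on the random samples `ξ 0, ξ 1, …`. -/
def HighProbBound {Ω : Type*} [MeasurableSpace Ω] (μ : Measure Ω) (ξ : ℕ → Ω → Ξ)
    (Q : Set (Vec p n)) (P : Measure Ξ) (F : Vec p n → Ξ → ℝ) (G : Vec p n → Ξ → Vec q n)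
    (d : Vec p n → ℝ) (x₀ xs : Vec p n) (M : ℝ) (N : ℕ) (σ C₁ C₂ : ℝ) : Prop :=
  1 - σ ≤ μ.real {ω |
    objective P F (average (iterate Q d x₀ G (stepSize (proxRadius Q d xs x₀) M N)
        (fun k => ξ k ω)) N) - objective P F xs
      ≤ C₁ * M / √(N : ℝ) *
        (proxRadius Q d xs x₀ + C₂ * setDiam Q * √(Real.log σ⁻¹))}

end Problem

end MirrorDescent

end

/-! The argument is the regret bound of mirror descent followed by a Chernoff bound for sums adapted
to the samples.

The first-order condition for the mirror step, strong convexity of `d`, Hölder and Young give h⟨G_k,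
x^k - x_*⟩ ≤ h²‖G_k‖²/2 + V(x_*, x^k) - V(x_*, x^{k+1}), which telescopes (`sum_pairing_le`). Write
U = ‖G‖²/M² (`gradSq`) and B = RM√(2/N)/2 (`bias`). With the prescribed step, convexity and
unbiasedness turn this into N(f(x̄) - f_*) ≤ NB + ∑ (B U_k + D_k) (`mul_objective_average_sub_le`).
Here D_k (`noise`) has mean zero once the past is fixed, and |D_k| ≤ S(1 + √U_k) with S = M R̄.

The point x^k depends only on samples before k, so the exponential moment of the sum is bounded by
integrating out one sample at a time (`lintegral_past`, `lintegral_prod_le`). A Cauchy–Schwarz-type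
inequality separates U from D, reducing the problem to one-sample bounds E exp(θU) ≤ exp(aθ) and E
exp(βD/S) ≤ exp(bβ²) (`highProbBound_of_exp_moments`). Under i) and ii) these hold on the whole
space. Under iii) they hold only on {U ≤ τ}, and a union bound over the N samples pays for the
truncation. Optimizing the Chernoff parameter gives a deviation of order B + S√(log σ⁻¹ / N). -/

namespace MirrorDescent

/-! ### Bilinearity, Hölder's inequality and integration of the pairing. -/

section Pairing

variable {p q : ℝ≥0∞} {n : ℕ}

lemma pairing_sub_left (v w : Vec q n) (x : Vec p n) :
    pairing (v - w) x = pairing v x - pairing w x := by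
  simp [pairing, sub_mul, Finset.sum_sub_distrib]

lemma pairing_smul_left (c : ℝ) (v : Vec q n) (x : Vec p n) :
    pairing (c • v) x = c * pairing v x := by
  simp [pairing, Finset.mul_sum, mul_assoc]

lemma pairing_add_right (v : Vec q n) (x y : Vec p n) :
    pairing v (x + y) = pairing v x + pairing v y := by
  simp [pairing, mul_add, Finset.sum_add_distrib]

lemma pairing_sub_right (v : Vec q n) (x y : Vec p n) :
    pairing v (x - y) = pairing v x - pairing v y := by
  simp [pairing, mul_sub, Finset.sum_sub_distrib]

lemma pairing_smul_right (c : ℝ) (v : Vec q n) (x : Vec p n) :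
    pairing v (c • x) = c * pairing v x := by
  simp only [pairing, PiLp.smul_apply, smul_eq_mul, Finset.mul_sum]
  exact Finset.sum_congr rfl fun _ _ => by ring

lemma pairing_comm (v : Vec q n) (x : Vec p n) : pairing v x = pairing x v := by
  simp [pairing, mul_comm]

lemma abs_pairing_le_top_one (v : Vec ∞ n) (x : Vec 1 n) : |pairing v x| ≤ ‖v‖ * ‖x‖ := by
  rw [PiLp.norm_eq_sum (by simp) x]
  simp only [ENNReal.toReal_one, Real.rpow_one, div_one, Finset.mul_sum]
  refine (Finset.abs_sum_le_sum_abs _ _).trans (Finset.sum_le_sum fun i _ => ?_)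
  rw [abs_mul]
  exact mul_le_mul_of_nonneg_right (PiLp.norm_apply_le v i) (abs_nonneg _)

/-- Hölder's inequality for the pairing. -/
lemma abs_pairing_le [Fact (1 ≤ p)] [Fact (1 ≤ q)] [hpq : p.HolderConjugate q]
    (v : Vec q n) (x : Vec p n) : |pairing v x| ≤ ‖v‖ * ‖x‖ := by
  by_cases hq : q = ∞
  · obtain rfl : p = 1 := (ENNReal.HolderConjugate.eq_top_iff_eq_one q p).1 hq
    subst hq
    exact abs_pairing_le_top_one v x
  by_cases hp : p = ∞
  · obtain rfl : q = 1 := (ENNReal.HolderConjugate.eq_top_iff_eq_one p q).1 hp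
    subst hp
    rw [pairing_comm, mul_comm]
    exact abs_pairing_le_top_one x v
  have h := ENNReal.HolderConjugate.toReal_of_ne_top hp hq
  rw [PiLp.norm_eq_sum h.pos x, PiLp.norm_eq_sum h.symm.pos v]
  refine (Finset.abs_sum_le_sum_abs _ _).trans ?_
  simp only [abs_mul]
  refine (Real.inner_le_Lp_mul_Lq _ _ _ h.symm).trans_eq ?_
  simp

lemma continuous_pairing [Fact (1 ≤ p)] [Fact (1 ≤ q)] :
    Continuous fun z : Vec q n × Vec p n => pairing z.1 z.2 := by
  unfold pairing
  fun_prop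

/-- The pairing with a fixed first argument as a continuous linear functional. -/
noncomputable def pairingCLM [Fact (1 ≤ p)] (v : Vec q n) : Vec p n →L[ℝ] ℝ :=
  LinearMap.toContinuousLinearMap
    { toFun := fun x => pairing v x
      map_add' := pairing_add_right v
      map_smul' := fun c x => pairing_smul_right c v x }

@[simp]
lemma pairingCLM_apply [Fact (1 ≤ p)] (v : Vec q n) (x : Vec p n) :
    pairingCLM v x = pairing v x := rfl

lemma integral_pairing_left [Fact (1 ≤ p)] [Fact (1 ≤ q)] {Ξ : Type*} [MeasurableSpace Ξ] {P : Measure Ξ}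
    {g : Ξ → Vec q n} (hg : Integrable g P) (x : Vec p n) :
    Integrable (fun s => pairing (g s) x) P ∧
      ∫ s, pairing (g s) x ∂P = pairing (∫ s, g s ∂P) x := by
  have h : ∀ v : Vec q n, pairing v x = pairingCLM x v := fun v => by
    rw [pairingCLM_apply, pairing_comm]
  simp only [h]
  exact ⟨(pairingCLM x).integrable_comp hg, (pairingCLM x).integral_comp_comm hg⟩

end Pairing

/-! ### The mirror step and its three-point inequality. -/

section Mirror

variable {p q : ℝ≥0∞} {n : ℕ}
  {Q : Set (Vec p n)} {d : Vec p n → ℝ} {x₀ : Vec p n}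

@[simp]
lemma bregman_self (x : Vec p n) : bregman Q d x x = 0 := by simp [bregman]

/-- The function minimized by the mirror step. -/
noncomputable def mirrObjective (Q : Set (Vec p n)) (d : Vec p n → ℝ) (y : Vec p n) (v : Vec q n)
    (x : Vec p n) : ℝ :=
  pairing v (x - y) + bregman Q d x y

lemma mirrObjective_sub (y z x : Vec p n) (v : Vec q n) :
    mirrObjective Q d y v x - mirrObjective Q d y v z =
      pairing v (x - z) - fderivWithin ℝ d Q y (x - z) + (d x - d z) := by
  simp only [mirrObjective, bregman, map_sub, pairing_sub_right]
  ring

variable [Fact (1 ≤ p)]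

/-- The directional derivative as a limit of difference quotients along a segment. -/
lemma tendsto_fderivWithin_segment (hQ : Convex ℝ Q) {x y : Vec p n} (hx : x ∈ Q) (hy : y ∈ Q)
    (hd : DifferentiableWithinAt ℝ d Q y) :
    Filter.Tendsto (fun m : ℕ => ((m : ℝ) + 1) * (d (y + ((m : ℝ) + 1)⁻¹ • (x - y)) - d y))
      Filter.atTop (nhds (fderivWithin ℝ d Q y (x - y))) := by
  have h0 : Filter.Tendsto (fun m : ℕ => ((m : ℝ) + 1)⁻¹) Filter.atTop (nhds 0) := by
    simpa using tendsto_one_div_add_atTop_nhds_zero_nat (𝕜 := ℝ)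
  refine hd.hasFDerivWithinAt.lim (c := fun m : ℕ => (m : ℝ) + 1)
    (d := fun m : ℕ => ((m : ℝ) + 1)⁻¹ • (x - y)) (by simpa using h0.smul_const (x - y))
    (.of_forall fun m => ?_) (tendsto_const_nhds.congr fun m => ?_)
  · exact hQ.add_smul_sub_mem hy hx ⟨by positivity, inv_le_one_of_one_le₀ (by simp)⟩
  · rw [smul_smul, mul_inv_cancel₀ (by positivity), one_smul]

/-- Strong convexity bounds the Bregman divergence from below. -/
lemma half_sq_norm_le_bregman (hd : StrongConvexOn Q 1 d) {x y : Vec p n} (hx : x ∈ Q)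
    (hy : y ∈ Q) (hdy : DifferentiableWithinAt ℝ d Q y) :
    1 / 2 * ‖x - y‖ ^ 2 ≤ bregman Q d x y := by
  have h0 : Filter.Tendsto (fun m : ℕ => ((m : ℝ) + 1)⁻¹) Filter.atTop (nhds 0) := by
    simpa using tendsto_one_div_add_atTop_nhds_zero_nat (𝕜 := ℝ)
  have hlim := ((tendsto_const_nhds (x := (1 : ℝ))).sub h0).mul_const (1 / 2 * ‖x - y‖ ^ 2)
  rw [sub_zero, one_mul] at hlim
  have hlim' := (tendsto_const_nhds (x := d x - d y)).sub
    (tendsto_fderivWithin_segment hd.1 hx hy hdy)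
  refine le_of_tendsto_of_tendsto' hlim hlim' fun m => ?_
  have hm : (0 : ℝ) < (m : ℝ) + 1 := by positivity
  have hle : ((m : ℝ) + 1)⁻¹ ≤ 1 := inv_le_one_of_one_le₀ (by simp)
  -- Strong convexity at weight 1/(m+1), multiplied by m+1, bounds the difference quotient of `d`;
  -- the quadratic term keeps a factor 1 - 1/(m+1), which tends to 1.
  have h := hd.2 hx hy (inv_nonneg.2 hm.le) (sub_nonneg.2 hle) (by ring)
  have hpt : ((m : ℝ) + 1)⁻¹ • x + (1 - ((m : ℝ) + 1)⁻¹) • y =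
      y + ((m : ℝ) + 1)⁻¹ • (x - y) := by module
  rw [hpt] at h
  simp only [smul_eq_mul] at h
  have h' := mul_le_mul_of_nonneg_left h hm.le
  have hmi : ((m : ℝ) + 1) * ((m : ℝ) + 1)⁻¹ = 1 := mul_inv_cancel₀ hm.ne'
  have e : ((m : ℝ) + 1) * (((m : ℝ) + 1)⁻¹ * d x + (1 - ((m : ℝ) + 1)⁻¹) * d y -
      ((m : ℝ) + 1)⁻¹ * (1 - ((m : ℝ) + 1)⁻¹) * (1 / 2 * ‖x - y‖ ^ 2)) =
      d x - d y + ((m : ℝ) + 1) * d y - (1 - ((m : ℝ) + 1)⁻¹) * (1 / 2 * ‖x - y‖ ^ 2) := by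
    linear_combination (d x - d y - (1 - ((m : ℝ) + 1)⁻¹) * (1 / 2 * ‖x - y‖ ^ 2)) * hmi
  rw [e] at h'
  linarith

lemma continuousOn_mirrObjective (hd : ContinuousOn d Q) (y : Vec p n) (v : Vec q n) :
    ContinuousOn (mirrObjective Q d y v) Q := by
  have h : Continuous fun x => pairing v (x - y) :=
    (pairingCLM v).continuous.comp (continuous_id.sub continuous_const)
  exact h.continuousOn.add ((hd.sub continuousOn_const).sub
    ((fderivWithin ℝ d Q y).continuous.comp (continuous_id.sub continuous_const)).continuousOn)

variable (hQ : IsCompact Q) (hP : IsProxFunction Q d x₀)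
include hP

/-- The start minimizes `d` on `Q`, so 0 is a subgradient there. -/
lemma IsProxFunction.differentiableWithinAt_start : DifferentiableWithinAt ℝ d Q x₀ :=
  hP.differentiable x₀ hP.start_mem ⟨0, fun x hx => by
    simpa [hP.start_eq_zero] using hP.nonneg x hx⟩

include hQ

lemma mirr_spec (y : Vec p n) (v : Vec q n) :
    mirr Q d y v ∈ Q ∧ IsMinOn (mirrObjective Q d y v) Q (mirr Q d y v) := by
  have h : ∃ z ∈ Q, IsMinOn (fun x => pairing v (x - y) + bregman Q d x y) Q z :=
    hQ.exists_isMinOn ⟨x₀, hP.start_mem⟩ (continuousOn_mirrObjective hP.continuousOn y v)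
  rw [mirr, dif_pos h]
  exact h.choose_spec

/-- On `Q` the minimized function is `d` plus an affine function, so its minimizer carries a
subgradient of `d`, and the last clause of `IsProxFunction` applies. Thus iterates never meet points
where `d` lacks a gradient, such as the boundary of the simplex for the entropy. -/
lemma differentiableWithinAt_mirr (y : Vec p n) (v : Vec q n) :
    DifferentiableWithinAt ℝ d Q (mirr Q d y v) := by
  obtain ⟨hz, hmin⟩ := mirr_spec hQ hP y v
  refine hP.differentiable _ hz ⟨fderivWithin ℝ d Q y - pairingCLM v, fun x hx => ?_⟩
  have h := isMinOn_iff.1 hmin x hx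
  have h' := mirrObjective_sub (Q := Q) (d := d) y (mirr Q d y v) x v
  simp only [sub_apply, pairingCLM_apply]
  linarith

/-- The minimized function grows at least like the Bregman divergence from its minimizer. -/
lemma mirrObjective_mirr_add_bregman_le (y : Vec p n) (v : Vec q n) {x : Vec p n} (hx : x ∈ Q) :
    mirrObjective Q d y v (mirr Q d y v) + bregman Q d x (mirr Q d y v) ≤
      mirrObjective Q d y v x := by
  obtain ⟨hz, hmin⟩ := mirr_spec hQ hP y v
  set z := mirr Q d y v
  have hd := (differentiableWithinAt_mirr hQ hP y v).hasFDerivWithinAt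
  have hF : HasFDerivWithinAt (fun x => mirrObjective Q d y v x - mirrObjective Q d y v z)
      (pairingCLM v - fderivWithin ℝ d Q y + fderivWithin ℝ d Q z) Q z := by
    have h := ((pairingCLM v - fderivWithin ℝ d Q y).hasFDerivAt.hasFDerivWithinAt
      (s := Q) (x := z)).add (hd.sub_const (d z))
    refine (h.sub_const (pairing v z - fderivWithin ℝ d Q y z)).congr_of_eventuallyEq
      (.of_forall fun x => ?_) ?_ <;>
    simp only [mirrObjective_sub, pairing_sub_right, map_sub, sub_apply,
      Pi.add_apply, pairingCLM_apply] <;> ring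
  have hmin' : IsMinOn (fun x => mirrObjective Q d y v x - mirrObjective Q d y v z) Q z :=
    isMinOn_iff.2 fun x hx => sub_le_sub_right (isMinOn_iff.1 hmin x hx) _
  -- First-order optimality in the direction x - z: ⟨v, x - z⟩ - d'(y)(x - z) + d'(z)(x - z) ≥ 0.
  have h := hmin'.localize.hasFDerivWithinAt_nonneg hF
    (sub_mem_posTangentConeAt_of_segment_subset (hP.strongConvexOn.1.segment_subset hz hx))
  have h' := mirrObjective_sub (Q := Q) (d := d) y z x v
  simp only [sub_apply, add_apply,
    pairingCLM_apply] at h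
  unfold bregman
  linarith

/-- Quadratic growth makes the minimizer unique and lets near-minimizers converge to it, which gives
measurability of the iterates. -/
lemma mirrObjective_mirr_add_sq_le (y : Vec p n) (v : Vec q n) {x : Vec p n} (hx : x ∈ Q) :
    mirrObjective Q d y v (mirr Q d y v) + 1 / 2 * ‖x - mirr Q d y v‖ ^ 2 ≤
      mirrObjective Q d y v x :=
  (add_le_add_right (half_sq_norm_le_bregman hP.strongConvexOn hx (mirr_spec hQ hP y v).1
    (differentiableWithinAt_mirr hQ hP y v)) _).trans (mirrObjective_mirr_add_bregman_le hQ hP y v hx)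

/-- A mirror step with zero gradient does not move. -/
lemma mirr_zero {y : Vec p n} (hy : y ∈ Q) (hdy : DifferentiableWithinAt ℝ d Q y) :
    mirr Q d y (0 : Vec q n) = y := by
  have h := mirrObjective_mirr_add_sq_le hQ hP y (0 : Vec q n) hy
  have h0 : ∀ x : Vec p n, pairing (0 : Vec q n) x = 0 := fun x => by simp [pairing]
  simp only [mirrObjective, h0, zero_add, bregman_self] at h
  have h1 := half_sq_norm_le_bregman hP.strongConvexOn (mirr_spec hQ hP y (0 : Vec q n)).1 hy hdy
  have h2 : ‖y - mirr Q d y (0 : Vec q n)‖ = 0 := by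
    by_contra hne
    have := sq_pos_of_ne_zero hne
    nlinarith [sq_nonneg ‖mirr Q d y (0 : Vec q n) - y‖]
  exact (sub_eq_zero.1 (norm_eq_zero.1 h2)).symm

/-- The basic inequality of mirror descent. -/
lemma pairing_le_of_mirr [Fact (1 ≤ q)] [p.HolderConjugate q] {y : Vec p n} (hy : y ∈ Q)
    (hdy : DifferentiableWithinAt ℝ d Q y) (v : Vec q n) {x : Vec p n} (hx : x ∈ Q) :
    pairing v (y - x) ≤
      ‖v‖ ^ 2 / 2 + bregman Q d x y - bregman Q d x (mirr Q d y v) := by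
  have h := mirrObjective_mirr_add_bregman_le hQ hP y v hx
  obtain ⟨hz, -⟩ := mirr_spec hQ hP y v
  have h1 := half_sq_norm_le_bregman hP.strongConvexOn hz hy hdy
  have h2 := (abs_le.1 (abs_pairing_le v (mirr Q d y v - y))).1
  simp only [mirrObjective] at h
  have h3 : pairing v (y - x) = - pairing v (x - y) := by
    simp only [pairing_sub_right]; ring
  -- Young's inequality: the half square of the displacement is absorbed by V(z, y), where z is the
  -- mirror point.
  nlinarith [sq_nonneg (‖v‖ - ‖mirr Q d y v - y‖)]

end Mirror

/-! ### Measurability of the mirror step and of the iterates. -/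

section Measurability

/-- A strongly unique minimizer of a Carathéodory function depends measurably on the parameter. -/
lemma measurable_of_forall_add_sq_le {α E : Type*} [MeasurableSpace α] [NormedAddCommGroup E]
    [MeasurableSpace E] [BorelSpace E] [SecondCountableTopology E] {Q : Set E}
    {φ : α → E → ℝ} (hφ : ∀ x ∈ Q, Measurable fun a => φ a x) (hc : ∀ a, ContinuousOn (φ a) Q)
    {z : α → E} (hz : ∀ a, z a ∈ Q)
    (hmin : ∀ a, ∀ x ∈ Q, φ a (z a) + 1 / 2 * ‖x - z a‖ ^ 2 ≤ φ a x) : Measurable z := by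
  classical
  rcases isEmpty_or_nonempty α with hα | ⟨⟨a₀⟩⟩
  · exact measurable_of_empty z
  have : Nonempty Q := ⟨⟨z a₀, hz a₀⟩⟩
  set e : ℕ → Q := TopologicalSpace.denseSeq Q with he
  have hde : DenseRange e := TopologicalSpace.denseRange_denseSeq Q
  have hcr : ∀ a, Continuous fun x : Q => φ a x := fun a => (hc a).domRestrict
  have hzle : ∀ a, ∀ x : Q, φ a (z a) ≤ φ a x := fun a x =>
    le_trans (le_add_of_nonneg_right (by positivity)) (hmin a x x.2)
  -- Near-optimality is tested against the dense sequence rather than against `z a`, whose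
  -- measurability is the claim. The first near-optimal index is then measurable, and quadratic
  -- growth sends the chosen points to `z a`.
  have hex : ∀ m : ℕ, ∀ a, ∃ i, ∀ j, φ a (e i) ≤ φ a (e j) + 1 / ((m : ℝ) + 1) := by
    intro m a
    have hm : (0 : ℝ) < 1 / ((m : ℝ) + 1) := by positivity
    obtain ⟨i, hi⟩ := hde.exists_mem_open
      (isOpen_lt (hcr a) (continuous_const (y := φ a (z a) + 1 / ((m : ℝ) + 1))))
      ⟨⟨z a, hz a⟩, by simpa using hm⟩
    exact ⟨i, fun j => le_trans (le_of_lt hi) (add_le_add_left (hzle a (e j)) _)⟩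
  refine measurable_of_tendsto_metrizable (f := fun m a => (e (Nat.find (hex m a)) : E))
    (fun m => ?_) (tendsto_pi_nhds.2 fun a => ?_)
  · have hf : Measurable fun a => Nat.find (hex m a) := by
      refine measurable_find (hex m) fun i => ?_
      have : {a | ∀ j, φ a (e i) ≤ φ a (e j) + 1 / ((m : ℝ) + 1)} =
          ⋂ j, {a | φ a (e i) ≤ φ a (e j) + 1 / ((m : ℝ) + 1)} := by ext; simp
      rw [this]
      exact MeasurableSet.iInter fun j => measurableSet_le (hφ _ (e i).2)
        ((hφ _ (e j).2).add_const _)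
    exact (measurable_from_nat (f := fun i => (e i : E))).comp hf
  · have h1 : ∀ m : ℕ, ‖(e (Nat.find (hex m a)) : E) - z a‖ ≤ √(2 * (1 / ((m : ℝ) + 1))) := by
      intro m
      have hi := Nat.find_spec (hex m a)
      set i := Nat.find (hex m a)
      have hcl : ∀ x : Q, φ a (e i) ≤ φ a x + 1 / ((m : ℝ) + 1) := by
        intro x
        exact hde.induction_on (p := fun x : Q => φ a (e i) ≤ φ a x + 1 / ((m : ℝ) + 1)) x
          (isClosed_le continuous_const ((hcr a).add continuous_const)) hi
      have h2 := hcl ⟨z a, hz a⟩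
      have h3 := hmin a (e i) (e i).2
      refine Real.le_sqrt_of_sq_le ?_
      simp only at h2
      linarith
    refine tendsto_iff_norm_sub_tendsto_zero.2
      (squeeze_zero (fun _ => norm_nonneg _) h1 ?_)
    have h4 := (tendsto_one_div_add_atTop_nhds_zero_nat (𝕜 := ℝ)).const_mul 2
    simpa using h4.sqrt

variable {p q : ℝ≥0∞} [Fact (1 ≤ p)] {n : ℕ}
  {Q : Set (Vec p n)} {d : Vec p n → ℝ} {x₀ : Vec p n} {α : Type*} [MeasurableSpace α]

lemma measurable_comp_of_continuousOn {E : Type*} [TopologicalSpace E] [MeasurableSpace E]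
    [BorelSpace E] {Q : Set E} {d : E → ℝ} (hd : ContinuousOn d Q)
    {X : α → E} (hX : Measurable X) (hXQ : ∀ a, X a ∈ Q) : Measurable fun a => d (X a) :=
  hd.domRestrict.measurable.comp (hX.subtype_mk (h := hXQ))

/-- The directional derivative towards a point of `Q` is a limit of difference quotients along the
segment, and these use only values of `d` on `Q`, where it is continuous. -/
lemma measurable_fderivWithin_apply_sub (hP : IsProxFunction Q d x₀) {X : α → Vec p n}
    (hX : Measurable X) (hXQ : ∀ a, X a ∈ Q)
    (hXd : ∀ a, DifferentiableWithinAt ℝ d Q (X a)) {x : Vec p n} (hx : x ∈ Q) :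
    Measurable fun a => fderivWithin ℝ d Q (X a) (x - X a) := by
  refine measurable_of_tendsto_metrizable
    (f := fun (m : ℕ) a => ((m : ℝ) + 1) * (d (X a + ((m : ℝ) + 1)⁻¹ • (x - X a)) - d (X a)))
    (fun m => ?_)
    (tendsto_pi_nhds.2 fun a => tendsto_fderivWithin_segment hP.strongConvexOn.1 hx (hXQ a) (hXd a))
  refine ((measurable_comp_of_continuousOn hP.continuousOn ?_ fun a => ?_).sub
    (measurable_comp_of_continuousOn hP.continuousOn hX hXQ)).const_mul _
  · exact hX.add (((continuous_const_smul _).comp (continuous_sub_left x)).measurable.comp hX)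
  · exact hP.strongConvexOn.1.add_smul_sub_mem (hXQ a) hx
      ⟨by positivity, inv_le_one_of_one_le₀ (by simp)⟩

lemma measurable_mirr [Fact (1 ≤ q)] (hQ : IsCompact Q) (hP : IsProxFunction Q d x₀)
    {X : α → Vec p n} (hX : Measurable X) (hXQ : ∀ a, X a ∈ Q)
    (hXd : ∀ a, DifferentiableWithinAt ℝ d Q (X a)) {v : α → Vec q n} (hv : Measurable v) :
    Measurable fun a => mirr Q d (X a) (v a) := by
  refine measurable_of_forall_add_sq_le (φ := fun a => mirrObjective Q d (X a) (v a))
    (fun x hx => ?_) (fun a => continuousOn_mirrObjective hP.continuousOn _ _)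
    (fun a => (mirr_spec hQ hP _ _).1) fun a x hx => mirrObjective_mirr_add_sq_le hQ hP _ _ hx
  refine (continuous_pairing.measurable.comp (hv.prodMk (hX.const_sub x))).add
    (((measurable_const.sub (measurable_comp_of_continuousOn hP.continuousOn hX hXQ))).sub
      (measurable_fderivWithin_apply_sub hP hX hXQ hXd hx))

variable {Ξ : Type*} {G : Vec p n → Ξ → Vec q n} {h : ℝ}

lemma iterate_spec (hQ : IsCompact Q) (hP : IsProxFunction Q d x₀) (s : ℕ → Ξ) (k : ℕ) :
    iterate Q d x₀ G h s k ∈ Q ∧ DifferentiableWithinAt ℝ d Q (iterate Q d x₀ G h s k) := by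
  cases k with
  | zero => exact ⟨hP.start_mem, hP.differentiableWithinAt_start⟩
  | succ k => exact ⟨(mirr_spec hQ hP _ _).1, differentiableWithinAt_mirr hQ hP _ _⟩

lemma measurable_iterate [Fact (1 ≤ q)] [MeasurableSpace Ξ] (hQ : IsCompact Q)
    (hP : IsProxFunction Q d x₀) (hG : Measurable (Function.uncurry G)) (ζ : ℕ → α → Ξ) (k : ℕ)
    (hζ : ∀ i < k, Measurable (ζ i)) :
    Measurable fun a => iterate Q d x₀ G h (fun i => ζ i a) k := by
  induction k with
  | zero => exact measurable_const
  | succ k ih =>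
    have hX := ih fun i hi => hζ i (hi.trans k.lt_succ_self)
    exact measurable_mirr hQ hP hX (fun a => (iterate_spec hQ hP _ k).1)
      (fun a => (iterate_spec hQ hP _ k).2)
      ((hG.comp (hX.prodMk (hζ k k.lt_succ_self))).const_smul h)

end Measurability

/-! ### Averages and the telescoped regret inequality. -/

section Regret

variable {p q : ℝ≥0∞} {n : ℕ} {Q : Set (Vec p n)} {d : Vec p n → ℝ} {x₀ : Vec p n}
  {Ξ : Type*} {G : Vec p n → Ξ → Vec q n} {h : ℝ}

lemma average_mem (hQ : Convex ℝ Q) {x : ℕ → Vec p n} {N : ℕ} (hN : 0 < N)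
    (hx : ∀ k, x k ∈ Q) : average x N ∈ Q := by
  rw [average, Finset.smul_sum]
  exact hQ.sum_mem (fun _ _ => by positivity) (by simp [hN.ne']) fun k _ => hx k

lemma mul_average_le {f : Vec p n → ℝ} (hf : ConvexOn ℝ Q f) {x : ℕ → Vec p n} {N : ℕ}
    (hN : 0 < N) (hx : ∀ k, x k ∈ Q) : N * f (average x N) ≤ ∑ k ∈ Finset.range N, f (x k) := by
  have hN' : (0 : ℝ) < N := by exact_mod_cast hN
  rw [average, Finset.smul_sum, ← le_inv_mul_iff₀ hN', Finset.mul_sum]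
  exact hf.map_sum_le (fun _ _ => by positivity) (by simp [hN.ne']) fun k _ => hx k

variable [Fact (1 ≤ p)]

lemma iterate_eq_start (hQ : IsCompact Q) (hP : IsProxFunction Q d x₀) (s : ℕ → Ξ) (k : ℕ) :
    iterate Q d x₀ G 0 s k = x₀ := by
  induction k with
  | zero => rfl
  | succ k ih =>
    rw [iterate, ih, zero_smul, mirr_zero hQ hP hP.start_mem hP.differentiableWithinAt_start]

lemma sum_pairing_le [Fact (1 ≤ q)] [p.HolderConjugate q] (hQ : IsCompact Q)
    (hP : IsProxFunction Q d x₀) (s : ℕ → Ξ) {x : Vec p n} (hx : x ∈ Q) (N : ℕ) :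
    ∑ k ∈ Finset.range N, h * pairing (G (iterate Q d x₀ G h s k) (s k))
      (iterate Q d x₀ G h s k - x) ≤
    (∑ k ∈ Finset.range N, h ^ 2 * ‖G (iterate Q d x₀ G h s k) (s k)‖ ^ 2 / 2)
      + bregman Q d x x₀ - bregman Q d x (iterate Q d x₀ G h s N) := by
  induction N with
  | zero => simp [iterate]
  | succ N ih =>
    rw [Finset.sum_range_succ, Finset.sum_range_succ]
    obtain ⟨h1, h2⟩ := iterate_spec (G := G) (h := h) hQ hP s N
    have h3 := pairing_le_of_mirr hQ hP h1 h2 (h • G (iterate Q d x₀ G h s N) (s N)) hx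
    rw [pairing_smul_left, norm_smul, mul_pow, Real.norm_eq_abs, sq_abs] at h3
    rw [iterate]
    linarith

end Regret

/-! ### Chernoff bound for sums adapted to independent samples. -/

section Chernoff

variable {Ω Ξ E : Type*} [MeasurableSpace Ξ] [MeasurableSpace E] {ξ : ℕ → Ω → Ξ}

/-- The σ-algebra generated by the samples with index below `k`. -/
@[reducible]
def past (ξ : ℕ → Ω → Ξ) (k : ℕ) : MeasurableSpace Ω :=
  ⨆ i ∈ Set.Iio k, MeasurableSpace.comap (ξ i) inferInstance

lemma past_mono : Monotone (past ξ) := fun _ _ h =>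
  biSup_mono fun _ hi => lt_of_lt_of_le hi h

lemma measurable_past {i k : ℕ} (h : i < k) : Measurable[past ξ k] (ξ i) :=
  measurable_iff_comap_le.2
    (le_iSup₂ (f := fun i (_ : i ∈ Set.Iio k) => MeasurableSpace.comap (ξ i) _) i h)

variable [MeasurableSpace Ω] {μ : Measure Ω} {P : Measure Ξ}

lemma past_le (hξ : ∀ k, Measurable (ξ k)) (k : ℕ) : past ξ k ≤ ‹MeasurableSpace Ω› :=
  iSup₂_le fun i _ => (hξ i).comap_le

variable (hξ : ∀ k, Measurable (ξ k)) (hind : iIndepFun ξ μ)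
  (hlaw : ∀ k, μ.map (ξ k) = P)
include hξ hind

lemma indepFun_of_measurable_past {β : Type*} [MeasurableSpace β] {k : ℕ} {Y : Ω → β}
    (hY : Measurable[past ξ k] Y) : Y ⟂ᵢ[μ] ξ k := by
  have h := indep_iSup_of_disjoint (fun i => (hξ i).comap_le) hind
    (S := Set.Iio k) (T := {k}) (by simp)
  rw [IndepFun_iff_Indep]
  refine indep_of_indep_of_le_left (indep_of_indep_of_le_right h ?_)
    (measurable_iff_comap_le.1 hY)
  simp

variable [IsProbabilityMeasure μ]
include hlaw

/-- Integrating out the newest sample. -/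
lemma lintegral_past {β : Type*} [MeasurableSpace β] {k : ℕ} {Y : Ω → β}
    (hY : Measurable[past ξ k] Y) {g : β × Ξ → ℝ≥0∞} (hg : Measurable g) :
    ∫⁻ ω, g (Y ω, ξ k ω) ∂μ = ∫⁻ ω, ∫⁻ s, g (Y ω, s) ∂P ∂μ := by
  have hY' : Measurable Y := hY.mono (past_le hξ k) le_rfl
  have h := (indepFun_iff_map_prod_eq_prod_map_map hY'.aemeasurable (hξ k).aemeasurable).1
    (indepFun_of_measurable_past hξ hind hY)
  have hP : IsProbabilityMeasure P := hlaw k ▸ Measure.isProbabilityMeasure_map (hξ k).aemeasurable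
  rw [← lintegral_map (f := g) hg (hY'.prodMk (hξ k)), h, hlaw k, lintegral_prod _ hg.aemeasurable,
    lintegral_map hg.lintegral_prod_right' hY']

variable {X : ℕ → Ω → E} (hX : ∀ k, Measurable[past ξ k] (X k))
include hX

/-- The newest sample is integrated first: the earlier factors and `X N` are measurable for the
past, so only the last factor sees it. This replaces conditional expectations. -/
lemma lintegral_prod_le {W : E × Ξ → ℝ≥0∞} (hW : Measurable W) {c : ℝ≥0∞}
    (hc : ∀ k ω, ∫⁻ s, W (X k ω, s) ∂P ≤ c) (N : ℕ) :
    ∫⁻ ω, ∏ k ∈ Finset.range N, W (X k ω, ξ k ω) ∂μ ≤ c ^ N := by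
  induction N with
  | zero => simp
  | succ N ih =>
    have hprod : Measurable[past ξ N] fun ω => ∏ k ∈ Finset.range N, W (X k ω, ξ k ω) := by
      refine @Finset.measurable_fun_prod _ _ _ _ _ _ (past ξ N) _ _ fun k hk => ?_
      have hk := Finset.mem_range.1 hk
      exact hW.comp (((hX k).mono (past_mono hk.le) le_rfl).prodMk (measurable_past hk))
    have h := lintegral_past hξ hind hlaw (g := fun z : (ℝ≥0∞ × E) × Ξ => z.1.1 * W (z.1.2, z.2))
      (hprod.prodMk (hX N)) (by fun_prop)
    simp only [Finset.prod_range_succ]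
    rw [h]
    have hWx : ∀ x, Measurable fun s => W (x, s) := fun x => hW.comp measurable_prodMk_left
    simp only [lintegral_const_mul _ (hWx _)]
    calc ∫⁻ ω, (∏ k ∈ Finset.range N, W (X k ω, ξ k ω)) * ∫⁻ s, W (X N ω, s) ∂P ∂μ
        ≤ ∫⁻ ω, (∏ k ∈ Finset.range N, W (X k ω, ξ k ω)) * c ∂μ :=
          lintegral_mono fun ω => mul_le_mul_right (hc N ω) _
      _ = (∫⁻ ω, ∏ k ∈ Finset.range N, W (X k ω, ξ k ω) ∂μ) * c :=
          lintegral_mul_const _ (hprod.mono (past_le hξ N) le_rfl)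
      _ ≤ c ^ (N + 1) := by rw [pow_succ]; exact mul_le_mul_left ih c

/-- A Chernoff bound for adapted sums, with truncation to a good set. -/
lemma measure_sum_ge_le {Z : E × Ξ → ℝ} (hZ : Measurable Z) {A : Set (E × Ξ)}
    (hA : MeasurableSet A) {l ρ t : ℝ} {π : ℝ≥0∞} (hl : 0 ≤ l)
    (hexp : ∀ k ω, ∫⁻ s in {s | (X k ω, s) ∈ A}, ENNReal.ofReal (Real.exp (l * Z (X k ω, s))) ∂P ≤
      ENNReal.ofReal (Real.exp ρ))
    (hbad : ∀ k ω, P {s | (X k ω, s) ∉ A} ≤ π) (N : ℕ) :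
    μ {ω | t ≤ ∑ k ∈ Finset.range N, Z (X k ω, ξ k ω)} ≤
      ENNReal.ofReal (Real.exp (N * ρ - l * t)) + N * π := by
  have hX' : ∀ k, Measurable (X k) := fun k => (hX k).mono (past_le hξ k) le_rfl
  -- With the indicator inside each factor, truncation respects the product structure. If no sample
  -- leaves `A` the product is exactly exp(l ∑ Z); the exceptional samples go to a union bound.
  set W : E × Ξ → ℝ≥0∞ := A.indicator fun z => ENNReal.ofReal (Real.exp (l * Z z)) with hWdef
  have hW : Measurable W :=
    Measurable.indicator (by fun_prop) hA
  have hprodm : Measurable fun ω => ∏ k ∈ Finset.range N, W (X k ω, ξ k ω) :=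
    Finset.measurable_fun_prod _ fun k _ => hW.comp ((hX' k).prodMk (hξ k))
  have hsub : {ω | t ≤ ∑ k ∈ Finset.range N, Z (X k ω, ξ k ω)} ⊆
      {ω | ENNReal.ofReal (Real.exp (l * t)) ≤ ∏ k ∈ Finset.range N, W (X k ω, ξ k ω)} ∪
      ⋃ k ∈ Finset.range N, {ω | (X k ω, ξ k ω) ∉ A} := by
    intro ω hω
    by_cases hb : ∃ k ∈ Finset.range N, (X k ω, ξ k ω) ∉ A
    · obtain ⟨k, hk, hk'⟩ := hb
      exact Or.inr (Set.mem_biUnion hk hk')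
    · push Not at hb
      refine Or.inl ?_
      have : ∏ k ∈ Finset.range N, W (X k ω, ξ k ω) =
          ENNReal.ofReal (Real.exp (l * ∑ k ∈ Finset.range N, Z (X k ω, ξ k ω))) := by
        rw [Finset.mul_sum, Real.exp_sum, ENNReal.ofReal_prod_of_nonneg fun _ _ => by positivity]
        exact Finset.prod_congr rfl fun k hk => Set.indicator_of_mem (hb k hk) _
      rw [Set.mem_ofPred_eq, this]
      exact ENNReal.ofReal_le_ofReal (Real.exp_le_exp.2 (mul_le_mul_of_nonneg_left hω hl))
  refine (measure_mono hsub).trans ((measure_union_le _ _).trans (add_le_add ?_ ?_))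
  · have h := meas_ge_le_lintegral_div (μ := μ) hprodm.aemeasurable
      (ε := ENNReal.ofReal (Real.exp (l * t))) (by simp [Real.exp_pos]) ENNReal.ofReal_ne_top
    refine h.trans ?_
    rw [sub_eq_add_neg, Real.exp_add, ENNReal.ofReal_mul (Real.exp_pos _).le, Real.exp_neg,
      ENNReal.ofReal_inv_of_pos (Real.exp_pos _), ← div_eq_mul_inv]
    refine ENNReal.div_le_div_right ?_ _
    rw [Real.exp_nat_mul, ENNReal.ofReal_pow (Real.exp_pos _).le]
    refine lintegral_prod_le hξ hind hlaw hX hW (fun k ω => ?_) N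
    exact (lintegral_indicator (measurable_prodMk_left hA) _).trans_le (hexp k ω)
  · refine (measure_biUnion_finset_le _ _).trans ?_
    calc ∑ k ∈ Finset.range N, μ {ω | (X k ω, ξ k ω) ∉ A}
        ≤ ∑ k ∈ Finset.range N, π := Finset.sum_le_sum fun k _ => ?_
      _ = N * π := by simp
    have hm : Measurable (Aᶜ.indicator (1 : E × Ξ → ℝ≥0∞)) := measurable_one.indicator hA.compl
    have h := lintegral_past hξ hind hlaw (hX k) hm
    have h1 : ∀ ω, ∫⁻ s, Aᶜ.indicator (1 : E × Ξ → ℝ≥0∞) (X k ω, s) ∂P = P {s | (X k ω, s) ∉ A} := by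
      intro ω
      exact lintegral_indicator_one (s := {s | (X k ω, s) ∉ A}) (measurable_prodMk_left hA.compl)
    have h2 : ∫⁻ ω, Aᶜ.indicator (1 : E × Ξ → ℝ≥0∞) (X k ω, ξ k ω) ∂μ =
        μ {ω | (X k ω, ξ k ω) ∉ A} := by
      exact lintegral_indicator_one (s := {ω | (X k ω, ξ k ω) ∉ A})
        (((hX' k).prodMk (hξ k)) hA.compl)
    rw [← h2, h]
    refine (lintegral_mono fun ω => (h1 ω).trans_le (hbad k ω)).trans ?_
    simp

end Chernoff

/-! ### One-sample exponential moments under sub-Gaussian and polynomial tails. -/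

section ExpMoments

/-- For a centred variable the linear term integrates to zero, leaving an exponential of the square.
-/
lemma exp_le_add_exp_sq (x : ℝ) : Real.exp x ≤ x + Real.exp (x ^ 2) := by
  have h2 := Real.add_one_le_exp (x ^ 2)
  rcases le_or_gt |x| 1 with h | h
  · have h1 := (abs_le.1 (Real.abs_exp_sub_one_sub_id_le h)).2
    linarith
  · rcases lt_abs.1 h with h | h
    · have : Real.exp x ≤ Real.exp (x ^ 2) := Real.exp_le_exp.2 (by nlinarith)
      linarith
    · have : Real.exp x ≤ 1 := Real.exp_le_one_iff.2 (by linarith)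
      nlinarith

/-- A Taylor-type bound for the exponential on a half-line, with remainder of even order `m`. -/
lemma exp_le_of_le {z c : ℝ} (hz : z ≤ c) (m : ℕ) (hm : Even m) :
    Real.exp z ≤ 1 + z + z ^ 2 + z ^ m * Real.exp c := by
  have hm0 : 0 ≤ z ^ m := hm.pow_nonneg z
  have h0 := mul_nonneg hm0 (Real.exp_pos c).le
  rcases le_or_gt |z| 1 with h | h
  · have h1 := (abs_le.1 (Real.abs_exp_sub_one_sub_id_le h)).2
    linarith
  · rcases lt_abs.1 h with h | h
    · have h1 : Real.exp z ≤ Real.exp c := Real.exp_le_exp.2 hz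
      have h2 : 1 ≤ z ^ m := one_le_pow₀ h.le
      nlinarith [Real.exp_pos c]
    · have : Real.exp z ≤ 1 := Real.exp_le_one_iff.2 (by linarith)
      nlinarith

variable {Ξ : Type*} [MeasurableSpace Ξ] {P : Measure Ξ}

/-- The comparison is needed only on `S`, but the nonnegative majorant is integrated over the whole
space. Hence a variable of mean zero keeps mean zero exactly, although truncation to `S` would
destroy this. -/
lemma setLIntegral_ofReal_le {S : Set Ξ} (hS : MeasurableSet S) {f g : Ξ → ℝ} {c : ℝ}
    (hfg : ∀ s ∈ S, f s ≤ g s) (hg : ∀ s, 0 ≤ g s) (hgi : Integrable g P) (hc : ∫ s, g s ∂P ≤ c) :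
    ∫⁻ s in S, ENNReal.ofReal (f s) ∂P ≤ ENNReal.ofReal c := by
  calc ∫⁻ s in S, ENNReal.ofReal (f s) ∂P
      ≤ ∫⁻ s in S, ENNReal.ofReal (g s) ∂P :=
        setLIntegral_mono' hS fun s hs => ENNReal.ofReal_le_ofReal (hfg s hs)
    _ ≤ ∫⁻ s, ENNReal.ofReal (g s) ∂P := setLIntegral_le_lintegral _ _
    _ = ENNReal.ofReal (∫ s, g s ∂P) :=
        (ofReal_integral_eq_lintegral_ofReal hgi (.of_forall hg)).symm
    _ ≤ _ := ENNReal.ofReal_le_ofReal hc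

lemma integrable_of_lintegral_ofReal_le {f : Ξ → ℝ} (hf : Measurable f) (h0 : ∀ s, 0 ≤ f s) {c : ℝ}
    (hc : 0 ≤ c) (h : ∫⁻ s, ENNReal.ofReal (f s) ∂P ≤ ENNReal.ofReal c) :
    Integrable f P ∧ ∫ s, f s ∂P ≤ c := by
  have hi : Integrable f P :=
    ⟨hf.aestronglyMeasurable, (hasFiniteIntegral_iff_ofReal (.of_forall h0)).2
      (h.trans_lt ENNReal.ofReal_lt_top)⟩
  refine ⟨hi, ?_⟩
  rwa [← ofReal_integral_eq_lintegral_ofReal hi (.of_forall h0), ENNReal.ofReal_le_ofReal_iff hc] at h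

/-- A Cauchy–Schwarz-type bound for exponential moments. -/
lemma setLIntegral_exp_half_add_le {S : Set Ξ} {f g : Ξ → ℝ} (hf : Measurable f)
    (hg : Measurable g) {a b : ℝ}
    (ha : ∫⁻ s in S, ENNReal.ofReal (Real.exp (f s)) ∂P ≤ ENNReal.ofReal (Real.exp a))
    (hb : ∫⁻ s in S, ENNReal.ofReal (Real.exp (g s)) ∂P ≤ ENNReal.ofReal (Real.exp b)) :
    ∫⁻ s in S, ENNReal.ofReal (Real.exp ((f s + g s) / 2)) ∂P ≤
      ENNReal.ofReal (Real.exp ((a + b) / 2)) := by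
  -- AM–GM with weights that make the two integrated terms equal, which gives the geometric mean of
  -- the two bounds.
  have hpt : ∀ x y : ℝ, Real.exp ((x + y) / 2) ≤
      Real.exp ((b - a) / 2) / 2 * Real.exp x + Real.exp ((a - b) / 2) / 2 * Real.exp y := by
    intro x y
    have h1 : Real.exp ((b - a) / 2) * Real.exp x =
        Real.exp ((x + (b - a) / 2) / 2) ^ 2 := by
      rw [← Real.exp_add, ← Real.exp_nat_mul]; congr 1; push_cast; ring
    have h2 : Real.exp ((a - b) / 2) * Real.exp y =
        Real.exp ((y + (a - b) / 2) / 2) ^ 2 := by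
      rw [← Real.exp_add, ← Real.exp_nat_mul]; congr 1; push_cast; ring
    have h3 : Real.exp ((x + y) / 2) =
        Real.exp ((x + (b - a) / 2) / 2) * Real.exp ((y + (a - b) / 2) / 2) := by
      rw [← Real.exp_add]; congr 1; ring
    nlinarith [sq_nonneg (Real.exp ((x + (b - a) / 2) / 2) - Real.exp ((y + (a - b) / 2) / 2))]
  have e1 : ENNReal.ofReal (Real.exp ((b - a) / 2) / 2) * ENNReal.ofReal (Real.exp a) +
      ENNReal.ofReal (Real.exp ((a - b) / 2) / 2) * ENNReal.ofReal (Real.exp b) =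
      ENNReal.ofReal (Real.exp ((a + b) / 2)) := by
    rw [← ENNReal.ofReal_mul (by positivity), ← ENNReal.ofReal_mul (by positivity),
      ← ENNReal.ofReal_add (by positivity) (by positivity)]
    congr 1
    have h1 : Real.exp ((b - a) / 2) * Real.exp a = Real.exp ((a + b) / 2) := by
      rw [← Real.exp_add]; congr 1; ring
    have h2 : Real.exp ((a - b) / 2) * Real.exp b = Real.exp ((a + b) / 2) := by
      rw [← Real.exp_add]; congr 1; ring
    linarith
  calc ∫⁻ s in S, ENNReal.ofReal (Real.exp ((f s + g s) / 2)) ∂P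
      ≤ ∫⁻ s in S, (ENNReal.ofReal (Real.exp ((b - a) / 2) / 2) * ENNReal.ofReal (Real.exp (f s)) +
          ENNReal.ofReal (Real.exp ((a - b) / 2) / 2) * ENNReal.ofReal (Real.exp (g s))) ∂P := by
        refine lintegral_mono fun s => ?_
        rw [← ENNReal.ofReal_mul (by positivity), ← ENNReal.ofReal_mul (by positivity),
          ← ENNReal.ofReal_add (by positivity) (by positivity)]
        exact ENNReal.ofReal_le_ofReal (hpt _ _)
    _ = ENNReal.ofReal (Real.exp ((b - a) / 2) / 2) *
            ∫⁻ s in S, ENNReal.ofReal (Real.exp (f s)) ∂P +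
          ENNReal.ofReal (Real.exp ((a - b) / 2) / 2) *
            ∫⁻ s in S, ENNReal.ofReal (Real.exp (g s)) ∂P := by
        rw [lintegral_add_left (by fun_prop), lintegral_const_mul _ (by fun_prop),
          lintegral_const_mul _ (by fun_prop)]
    _ ≤ _ := (add_le_add (mul_le_mul_right ha _) (mul_le_mul_right hb _)).trans_eq e1

variable {U D : Ξ → ℝ}

section Tail

lemma lintegral_one_add_rpow {a : ℝ} (ha : 1 < a) :
    ∫⁻ t in Set.Ioi (0 : ℝ), ENNReal.ofReal ((1 + t) ^ (-a)) = ENNReal.ofReal (1 / (a - 1)) := by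
  have hi : IntegrableOn (fun t : ℝ => (1 + t) ^ (-a)) (Set.Ioi 0) := by
    simpa only [add_comm] using
      integrableOn_add_rpow_Ioi_of_lt (a := -a) (c := 0) (m := 1) (by linarith) (by norm_num)
  rw [← ofReal_integral_eq_lintegral_ofReal hi
    ((ae_restrict_iff' measurableSet_Ioi).2 (.of_forall fun t ht => by
      have : (0 : ℝ) < t := ht
      positivity))]
  congr 1
  have h := integral_Ioi_rpow_of_lt (a := -a) (by linarith) (c := 1) one_pos
  have h2 := (measurePreserving_add_left volume (1 : ℝ)).setIntegral_preimage_emb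
    (measurableEmbedding_addLeft 1) (fun t : ℝ => t ^ (-a)) (Set.Ioi 1)
  rw [Set.preimage_const_add_Ioi, sub_self, h] at h2
  rw [h2, Real.one_rpow, show -a + 1 = -(a - 1) by ring, neg_div_neg_eq]

variable {α : ℝ} (hα : 2 < α) (hUm : Measurable U) (hU0 : ∀ s, 0 ≤ U s)
  (hUt : ∀ t : ℝ, 0 ≤ t → P {s | t ≤ U s} ≤ ENNReal.ofReal ((1 + t) ^ (-α)))
include hα hUm hU0 hUt

lemma integrable_and_integral_le_one_of_tail : Integrable U P ∧ ∫ s, U s ∂P ≤ 1 := by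
  refine integrable_of_lintegral_ofReal_le hUm hU0 zero_le_one ?_
  rw [lintegral_eq_lintegral_meas_le P (.of_forall hU0) hUm.aemeasurable]
  calc ∫⁻ t in Set.Ioi (0 : ℝ), P {s | t ≤ U s}
      ≤ ∫⁻ t in Set.Ioi (0 : ℝ), ENNReal.ofReal ((1 + t) ^ (-α)) :=
        setLIntegral_mono' measurableSet_Ioi fun t ht => hUt t (le_of_lt ht)
    _ = ENNReal.ofReal (1 / (α - 1)) := lintegral_one_add_rpow (by linarith)
    _ ≤ _ := ENNReal.ofReal_le_ofReal ((div_le_one (by linarith)).2 (by linarith))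

/-- Layer-cake formula: one factor t lowers the exponent of the tail to α - 1, which stays
integrable precisely because α > 2. -/
lemma integrable_sq_and_integral_sq_le_of_tail :
    Integrable (fun s => U s ^ 2) P ∧ ∫ s, U s ^ 2 ∂P ≤ 2 / (α - 2) := by
  have hα' : 0 < α - 2 := by linarith
  refine integrable_of_lintegral_ofReal_le (hUm.pow_const 2) (fun s => sq_nonneg _)
    (by positivity) ?_
  have h := lintegral_rpow_eq_lintegral_meas_le_mul P (.of_forall hU0) hUm.aemeasurable
    (p := 2) two_pos
  simp only [Real.rpow_two] at h
  rw [h]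
  calc ENNReal.ofReal 2 * ∫⁻ t in Set.Ioi (0 : ℝ), P {s | t ≤ U s} * ENNReal.ofReal (t ^ (2 - 1 : ℝ))
      ≤ ENNReal.ofReal 2 *
          ∫⁻ t in Set.Ioi (0 : ℝ), ENNReal.ofReal ((1 + t) ^ (-(α - 1))) := by
        refine mul_le_mul_right (setLIntegral_mono' measurableSet_Ioi fun t ht => ?_) _
        have ht0 : (0 : ℝ) < t := ht
        refine (mul_le_mul_left (hUt t ht0.le) _).trans ?_
        rw [← ENNReal.ofReal_mul (by positivity)]
        refine ENNReal.ofReal_le_ofReal ?_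
        have e : (1 + t) ^ (-(α - 1)) = (1 + t) ^ (-α) * (1 + t) := by
          rw [show -(α - 1) = -α + 1 by ring, Real.rpow_add (by linarith), Real.rpow_one]
        rw [e]
        norm_num
        gcongr
        linarith
    _ = _ := by
        rw [lintegral_one_add_rpow (by linarith), ← ENNReal.ofReal_mul zero_le_two]
        congr 1
        rw [show α - 1 - 1 = α - 2 by ring]
        ring

end Tail

variable [IsProbabilityMeasure P]

section SubGaussian

variable (hU : Integrable (fun s => Real.exp (U s)) P) (hU1 : ∫ s, Real.exp (U s) ∂P ≤ Real.exp 1)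
include hU hU1

/-- By convexity exp(θ(U - 1)) ≤ θ exp(U - 1) + 1 - θ, and exp(U - 1) has mean at most 1. -/
lemma lintegral_exp_mul_le {θ : ℝ} (h0 : 0 ≤ θ) (h1 : θ ≤ 1) :
    ∫⁻ s in Set.univ, ENNReal.ofReal (Real.exp (θ * U s)) ∂P ≤ ENNReal.ofReal (Real.exp θ) := by
  refine setLIntegral_ofReal_le .univ
    (g := fun s => Real.exp θ * (θ * Real.exp (-1) * Real.exp (U s) + (1 - θ)))
    (fun s _ => ?_) (fun s => ?_) ?_ ?_
  · have h := convexOn_exp.2 (Set.mem_univ (U s - 1)) (Set.mem_univ 0) h0 (sub_nonneg.2 h1)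
      (by ring)
    simp only [smul_eq_mul, mul_zero, add_zero, Real.exp_zero, mul_one] at h
    have e1 : Real.exp (θ * U s) = Real.exp θ * Real.exp (θ * (U s - 1)) := by
      rw [← Real.exp_add]; congr 1; ring
    have e2 : θ * Real.exp (-1) * Real.exp (U s) = θ * Real.exp (U s - 1) := by
      rw [mul_assoc, ← Real.exp_add]; congr 2; ring
    rw [e1, e2]
    exact mul_le_mul_of_nonneg_left h (Real.exp_pos _).le
  · have := sub_nonneg.2 h1
    positivity
  · exact ((hU.const_mul _).add (integrable_const _)).const_mul _
  · rw [integral_const_mul, integral_add (hU.const_mul _) (integrable_const _), integral_const_mul]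
    simp only [integral_const, probReal_univ, smul_eq_mul, one_mul]
    have h2 := mul_le_mul_of_nonneg_left hU1 (mul_nonneg h0 (Real.exp_pos (-1)).le)
    have h3 : θ * Real.exp (-1) * Real.exp 1 = θ := by
      rw [mul_assoc, ← Real.exp_add]; simp
    nlinarith [Real.exp_pos θ]

variable (hU0 : ∀ s, 0 ≤ U s) (hD : Integrable D P) (hD0 : ∫ s, D s ∂P = 0)
  (hDU : ∀ s, |D s| ≤ 1 + √(U s))
include hU0 hD hD0 hDU

/-- For 2β² ≤ 1, `exp_le_add_exp_sq` removes the linear term and D² ≤ 2 + 2U reduces the rest to an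
exponential moment of U of order η = 2β² ≤ 1. For larger β centring is unnecessary: βD ≤ β + β²/4 +
U, and β + β²/4 + 1 ≤ 4β². -/
lemma lintegral_exp_mul_centered_le {β : ℝ} (hβ : 0 ≤ β) :
    ∫⁻ s in Set.univ, ENNReal.ofReal (Real.exp (β * D s)) ∂P ≤
      ENNReal.ofReal (Real.exp (4 * β ^ 2)) := by
  have hsq : ∀ s, √(U s) ^ 2 = U s := fun s => Real.sq_sqrt (hU0 s)
  rcases le_or_gt (2 * β ^ 2) 1 with hb | hb
  · set η := 2 * β ^ 2 with hη
    have hη0 : 0 ≤ η := by positivity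
    have hD2 : ∀ s, D s ^ 2 ≤ 2 + 2 * U s := fun s => by
      have h1 := sq_le_sq' (by linarith [abs_nonneg (D s), hDU s]) (hDU s)
      rw [sq_abs] at h1
      nlinarith [sq_nonneg (1 - √(U s)), hsq s]
    have hpt : ∀ s, Real.exp (β * D s) ≤
        β * D s + Real.exp (2 * η) * (η * Real.exp (-1) * Real.exp (U s) + (1 - η)) := fun s => by
      refine (exp_le_add_exp_sq _).trans (add_le_add_right ?_ _)
      have h := convexOn_exp.2 (Set.mem_univ (U s - 1)) (Set.mem_univ 0) hη0 (sub_nonneg.2 hb)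
        (by ring)
      simp only [smul_eq_mul, mul_zero, add_zero, Real.exp_zero, mul_one] at h
      have e2 : η * Real.exp (-1) * Real.exp (U s) = η * Real.exp (U s - 1) := by
        rw [mul_assoc, ← Real.exp_add]; congr 2; ring
      rw [e2]
      refine le_trans ?_ (mul_le_mul_of_nonneg_left h (Real.exp_pos _).le)
      rw [← Real.exp_add]
      refine Real.exp_le_exp.2 ?_
      have := mul_le_mul_of_nonneg_left (hD2 s) (sq_nonneg β)
      nlinarith
    have i1 : Integrable (fun s => Real.exp (2 * η) *
        (η * Real.exp (-1) * Real.exp (U s) + (1 - η))) P :=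
      ((hU.const_mul _).add (integrable_const _)).const_mul _
    refine setLIntegral_ofReal_le .univ (fun s _ => hpt s)
      (fun s => (Real.exp_pos _).le.trans (hpt s)) ((hD.const_mul _).add i1) ?_
    · rw [integral_add (hD.const_mul _) i1, integral_const_mul, hD0, integral_const_mul,
        integral_add (hU.const_mul _) (integrable_const _), integral_const_mul]
      simp only [integral_const, probReal_univ, smul_eq_mul, one_mul, mul_zero, zero_add]
      have h2 := mul_le_mul_of_nonneg_left hU1 (mul_nonneg hη0 (Real.exp_pos (-1)).le)
      have h3 : η * Real.exp (-1) * Real.exp 1 = η := by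
        rw [mul_assoc, ← Real.exp_add]; simp
      have h4 : 4 * β ^ 2 = 2 * η := by rw [hη]; ring
      rw [h4]
      nlinarith [Real.exp_pos (2 * η)]
  · refine setLIntegral_ofReal_le .univ
      (g := fun s => Real.exp (β + β ^ 2 / 4) * Real.exp (U s)) (fun s _ => ?_)
      (fun s => by positivity) (hU.const_mul _) ?_
    · rw [← Real.exp_add]
      refine Real.exp_le_exp.2 ?_
      have h1 := mul_le_mul_of_nonneg_left ((le_abs_self _).trans (hDU s)) hβ
      nlinarith [sq_nonneg (β / 2 - √(U s)), hsq s]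
    · rw [integral_const_mul]
      refine (mul_le_mul_of_nonneg_left hU1 (Real.exp_pos _).le).trans ?_
      rw [← Real.exp_add]
      refine Real.exp_le_exp.2 ?_
      nlinarith [sq_nonneg (β - 1)]

end SubGaussian

section Truncated

variable {v τ : ℝ} (hUm : Measurable U) (hU0 : ∀ s, 0 ≤ U s) (hU : Integrable U P)
  (hU1 : ∫ s, U s ∂P ≤ 1) (hU2 : Integrable (fun s => U s ^ 2) P) (hUv : ∫ s, U s ^ 2 ∂P ≤ v)
include hUm hU0 hU hU1 hU2 hUv

lemma setLIntegral_exp_mul_le {θ : ℝ} (h0 : 0 ≤ θ) :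
    ∫⁻ s in {s | U s ≤ τ}, ENNReal.ofReal (Real.exp (θ * U s)) ∂P ≤
      ENNReal.ofReal (Real.exp (θ + θ ^ 2 * (v * (1 + Real.exp (θ * τ))))) := by
  have i1 : Integrable (fun s => 1 + θ * U s) P := (integrable_const _).add (hU.const_mul _)
  refine setLIntegral_ofReal_le (measurableSet_le hUm measurable_const)
    (g := fun s => 1 + θ * U s + θ ^ 2 * (1 + Real.exp (θ * τ)) * U s ^ 2)
    (fun s hs => ?_) (fun s => ?_) ?_ ?_
  · have h := exp_le_of_le (mul_le_mul_of_nonneg_left hs h0) 2 (by decide)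
    linarith [mul_pow θ (U s) 2]
  · have := hU0 s
    positivity
  · exact i1.add (hU2.const_mul _)
  · rw [integral_add i1 (hU2.const_mul _),
      integral_add (integrable_const _) (hU.const_mul _), integral_const_mul, integral_const_mul]
    simp only [integral_const, probReal_univ, smul_eq_mul, one_mul]
    refine le_trans ?_ (Real.add_one_le_exp _)
    have h1 := mul_le_mul_of_nonneg_left hU1 h0
    have h2 := mul_le_mul_of_nonneg_left hUv
      (mul_nonneg (sq_nonneg θ) (add_nonneg zero_le_one (Real.exp_pos (θ * τ)).le))
    linarith

variable (hD : Integrable D P) (hD0 : ∫ s, D s ∂P = 0) (hDU : ∀ s, |D s| ≤ 1 + √(U s))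
include hD hD0 hDU

/-- The remainder in `exp_le_of_le` is taken of order 4, not 2: its large factor exp(2β√τ) then
comes with β⁴, and a spare β² can offset it. The fourth moment of D needs only the second moment of
U. -/
lemma setLIntegral_exp_mul_centered_le {β : ℝ} (h0 : 0 ≤ β) (hτ : 1 ≤ τ) :
    ∫⁻ s in {s | U s ≤ τ}, ENNReal.ofReal (Real.exp (β * D s)) ∂P ≤
      ENNReal.ofReal (Real.exp
        (4 * β ^ 2 + β ^ 4 * ((8 + 8 * v) * Real.exp (β * (2 * √τ))))) := by
  have hsq : ∀ s, √(U s) ^ 2 = U s := fun s => Real.sq_sqrt (hU0 s)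
  have hD2 : ∀ s, D s ^ 2 ≤ 2 + 2 * U s := fun s => by
    have h1 := sq_le_sq' (by linarith [abs_nonneg (D s), hDU s]) (hDU s)
    rw [sq_abs] at h1
    nlinarith [sq_nonneg (1 - √(U s)), hsq s]
  have hD4 : ∀ s, D s ^ 4 ≤ 8 + 8 * U s ^ 2 := fun s => by
    have h1 := pow_le_pow_left₀ (sq_nonneg (D s)) (hD2 s) 2
    nlinarith [sq_nonneg (1 - U s)]
  set c := Real.exp (β * (2 * √τ)) with hc
  have hc0 : 0 < c := Real.exp_pos _
  have hpt : ∀ s, 1 + β * D s + (β * D s) ^ 2 + (β * D s) ^ 4 * c ≤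
      1 + β * D s + β ^ 2 * (2 + 2 * U s) + β ^ 4 * c * (8 + 8 * U s ^ 2) := fun s => by
    have h1 := mul_le_mul_of_nonneg_left (hD2 s) (sq_nonneg β)
    have h2 := mul_le_mul_of_nonneg_left (hD4 s) (mul_nonneg (pow_nonneg h0 4) hc0.le)
    linarith [mul_pow β (D s) 2, mul_pow β (D s) 4]
  have i1 : Integrable (fun s => 1 + β * D s) P := (integrable_const _).add (hD.const_mul _)
  have i2 : Integrable (fun s => β ^ 2 * (2 + 2 * U s)) P :=
    ((integrable_const _).add (hU.const_mul _)).const_mul _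
  have i12 : Integrable (fun s => 1 + β * D s + β ^ 2 * (2 + 2 * U s)) P := i1.add i2
  have i3 : Integrable (fun s => β ^ 4 * c * (8 + 8 * U s ^ 2)) P :=
    ((integrable_const _).add (hU2.const_mul _)).const_mul _
  refine setLIntegral_ofReal_le (measurableSet_le hUm measurable_const)
    (g := fun s => 1 + β * D s + β ^ 2 * (2 + 2 * U s) + β ^ 4 * c * (8 + 8 * U s ^ 2))
    (fun s hs => ?_) (fun s => ?_) (i12.add i3) ?_
  · refine (exp_le_of_le ?_ 4 (by decide)).trans (hpt s)
    refine mul_le_mul_of_nonneg_left ?_ h0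
    have h1 : √(U s) ≤ √τ := Real.sqrt_le_sqrt hs
    have h2 : 1 ≤ √τ := Real.one_le_sqrt.2 hτ
    linarith [le_abs_self (D s), hDU s]
  · refine le_trans ?_ (hpt s)
    have : 0 ≤ (β * D s) ^ 4 * c := by positivity
    nlinarith [sq_nonneg (1 + β * D s), sq_nonneg (β * D s)]
  · rw [integral_add i12 i3, integral_add i1 i2,
      integral_add (integrable_const _) (hD.const_mul _), integral_const_mul, hD0,
      integral_const_mul, integral_const_mul,
      integral_add (integrable_const _) (hU.const_mul _),
      integral_add (integrable_const _) (hU2.const_mul _), integral_const_mul, integral_const_mul]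
    simp only [integral_const, probReal_univ, smul_eq_mul, one_mul]
    refine le_trans ?_ (Real.add_one_le_exp _)
    have h1 := mul_le_mul_of_nonneg_left hU1 (sq_nonneg β)
    have h2 := mul_le_mul_of_nonneg_left hUv (mul_nonneg (pow_nonneg h0 4) hc0.le)
    linarith

end Truncated

end ExpMoments

/-! ### From the regret bound and exponential moments to the probability bound. -/

section Assembly

variable {p q : ℝ≥0∞} {n : ℕ} {Q : Set (Vec p n)} {Ξ Ω : Type*} {G : Vec p n → Ξ → Vec q n}
  {d : Vec p n → ℝ} {x₀ xs : Vec p n} {M : ℝ}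

/-- The normalized squared norm of the stochastic subgradient. -/
noncomputable def gradSq (G : Vec p n → Ξ → Vec q n) (M : ℝ) (x : Vec p n) (s : Ξ) : ℝ :=
  ‖G x s‖ ^ 2 / M ^ 2

lemma gradSq_nonneg (x : Vec p n) (s : Ξ) : 0 ≤ gradSq G M x s := by
  unfold gradSq; positivity

variable [Fact (1 ≤ q)]

lemma sqrt_gradSq (hM : 0 < M) (x : Vec p n) (s : Ξ) : √(gradSq G M x s) = ‖G x s‖ / M := by
  rw [gradSq, ← div_pow, Real.sqrt_sq (by positivity)]

variable [MeasurableSpace Ξ] [MeasurableSpace Ω] {P : Measure Ξ} {F : Vec p n → Ξ → ℝ}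

/-- The error of the stochastic linearization at `x` in the direction of `xs`. -/
noncomputable def noise (P : Measure Ξ) (G : Vec p n → Ξ → Vec q n) (xs x : Vec p n) (s : Ξ) : ℝ :=
  pairing ((∫ s, G x s ∂P) - G x s) (x - xs)

lemma measurable_gradSq (hG : Measurable (Function.uncurry G)) :
    Measurable (Function.uncurry (gradSq G M)) :=
  (hG.norm.pow_const 2).div_const _

section Moments

variable [IsProbabilityMeasure P] {x : Vec p n} (hM : 0 < M)
  (hGi : Integrable (G x) P) (hU : Integrable (gradSq G M x) P) (hU1 : ∫ s, gradSq G M x s ∂P ≤ 1)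
include hM hGi hU hU1

lemma norm_integral_grad_le : ‖∫ s, G x s ∂P‖ ≤ M := by
  have hpt : ∀ s, ‖G x s‖ ≤ M / 2 * (1 + gradSq G M x s) := fun s => by
    have h := sq_nonneg (‖G x s‖ / M - 1)
    have h1 : ‖G x s‖ = M * (‖G x s‖ / M) := by field_simp
    rw [gradSq, ← div_pow]
    nlinarith
  calc ‖∫ s, G x s ∂P‖ ≤ ∫ s, ‖G x s‖ ∂P := norm_integral_le_integral_norm _
    _ ≤ ∫ s, M / 2 * (1 + gradSq G M x s) ∂P :=
        integral_mono hGi.norm (((integrable_const _).add hU).const_mul _) hpt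
    _ = M / 2 * (1 + ∫ s, gradSq G M x s ∂P) := by
        rw [integral_const_mul, integral_add (integrable_const _) hU]; simp
    _ ≤ M := by nlinarith

end Moments

variable [Fact (1 ≤ p)]

lemma norm_sub_le_setDiam (hQ : IsCompact Q) {x y : Vec p n} (hx : x ∈ Q) (hy : y ∈ Q) :
    ‖x - y‖ ≤ setDiam Q := by
  refine le_csSup ?_ ⟨x, hx, y, hy, rfl⟩
  refine ⟨Metric.diam Q, ?_⟩
  rintro r ⟨x, hx, y, hy, rfl⟩
  rw [← dist_eq_norm]
  exact Metric.dist_le_diam_of_mem hQ.isBounded hx hy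

lemma setDiam_nonneg (hQ : IsCompact Q) {x : Vec p n} (hx : x ∈ Q) : 0 ≤ setDiam Q :=
  (norm_nonneg _).trans (norm_sub_le_setDiam hQ hx hx)

lemma measurable_noise [SFinite P] (hG : Measurable (Function.uncurry G)) :
    Measurable (Function.uncurry (noise P G xs)) := by
  have h : Measurable fun x => ∫ s, G x s ∂P :=
    hG.stronglyMeasurable.integral_prod_right.measurable
  exact continuous_pairing.measurable.comp
    (((h.comp measurable_fst).sub hG).prodMk (measurable_fst.sub_const xs))

section Moments

variable [IsProbabilityMeasure P] {x : Vec p n} (hM : 0 < M)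
  (hGi : Integrable (G x) P) (hU : Integrable (gradSq G M x) P) (hU1 : ∫ s, gradSq G M x s ∂P ≤ 1)
include hM hGi hU hU1

variable [p.HolderConjugate q]

lemma abs_noise_le (hQ : IsCompact Q) (hx : x ∈ Q) (hxs : xs ∈ Q) (s : Ξ) :
    |noise P G xs x s| ≤ M * setDiam Q * (1 + √(gradSq G M x s)) := by
  refine (abs_pairing_le _ _).trans ?_
  have h1 : ‖(∫ s, G x s ∂P) - G x s‖ ≤ M * (1 + √(gradSq G M x s)) := by
    rw [sqrt_gradSq hM]
    refine (norm_sub_le _ _).trans ?_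
    have h1 : M * (‖G x s‖ / M) = ‖G x s‖ := by field_simp
    linarith [norm_integral_grad_le hM hGi hU hU1]
  refine (mul_le_mul h1 (norm_sub_le_setDiam hQ hx hxs) (norm_nonneg _) (by positivity)).trans_eq ?_
  ring

omit hM hU hU1 [p.HolderConjugate q] in
lemma integral_noise : Integrable (noise P G xs x) P ∧ ∫ s, noise P G xs x s ∂P = 0 := by
  have h := integral_pairing_left (g := fun s => (∫ s, G x s ∂P) - G x s)
    ((integrable_const _).sub hGi) (x - xs)
  refine ⟨h.1, h.2.trans ?_⟩
  rw [integral_sub (integrable_const _) hGi]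
  simp [pairing]

/-- The mean subgradient has norm at most M, so the gap of any point of `Q` is at most M R̄; this
settles the regime N ≤ log σ⁻¹ without probability. -/
lemma objective_sub_le (hS : IsStochasticProgram Q P F G) (hx : x ∈ Q) (hxs : xs ∈ Q) :
    objective P F x - objective P F xs ≤ M * setDiam Q := by
  have h := hS.unbiased x hx xs hxs
  have h1 := (abs_le.1 (abs_pairing_le (∫ s, G x s ∂P) (xs - x))).1
  have h2 := mul_le_mul (norm_integral_grad_le hM hGi hU hU1)
    (norm_sub_le_setDiam hS.isCompact hxs hx) (norm_nonneg _) hM.le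
  linarith

end Moments

/-- The deterministic part of the error bound. -/
noncomputable def bias (R M : ℝ) (N : ℕ) : ℝ := R * M * √(2 / N) / 2

lemma bias_eq (R M : ℝ) (N : ℕ) : bias R M N = √2 / 2 * (M / √N * R) := by
  rw [bias, Real.sqrt_div zero_le_two]
  ring

/-- The regret bound: the optimality gap of the average is controlled by adapted sums. -/
lemma mul_objective_average_sub_le [p.HolderConjugate q] (hS : IsStochasticProgram Q P F G)
    (hP : IsProxFunction Q d x₀) (hxs : xs ∈ Q) (hM : 0 < M) {N : ℕ} (hN : 0 < N)
    (hR : 0 < proxRadius Q d xs x₀) (s : ℕ → Ξ) {X : ℕ → Vec p n}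
    (hX : X = iterate Q d x₀ G (stepSize (proxRadius Q d xs x₀) M N) s) :
    N * (objective P F (average X N) - objective P F xs) ≤
      N * bias (proxRadius Q d xs x₀) M N + ∑ k ∈ Finset.range N,
        (bias (proxRadius Q d xs x₀) M N * gradSq G M (X k) (s k) + noise P G xs (X k) (s k)) := by
  set R := proxRadius Q d xs x₀ with hRdef
  set h := stepSize R M N with hh
  set B := bias R M N with hB
  have hN' : (0 : ℝ) < N := by exact_mod_cast hN
  have hXQ : ∀ k, X k ∈ Q := fun k => hX ▸ (iterate_spec hS.isCompact hP s k).1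
  have hw : 0 < √(2 / (N : ℝ)) := Real.sqrt_pos.2 (by positivity)
  have hw2 : √(2 / (N : ℝ)) ^ 2 = 2 / N := Real.sq_sqrt (by positivity)
  have hh0 : 0 < h := by rw [hh, stepSize]; positivity
  have hR2 : bregman Q d xs x₀ = R ^ 2 := by
    rw [hRdef, proxRadius, Real.sq_sqrt]
    exact (by positivity : (0 : ℝ) ≤ 1 / 2 * ‖xs - x₀‖ ^ 2).trans
      (half_sq_norm_le_bregman hP.strongConvexOn hxs hP.start_mem hP.differentiableWithinAt_start)
  have hVN : 0 ≤ bregman Q d xs (X N) :=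
    (by positivity : (0 : ℝ) ≤ 1 / 2 * ‖xs - X N‖ ^ 2).trans
      (half_sq_norm_le_bregman hP.strongConvexOn hxs (hXQ N)
        (hX ▸ (iterate_spec hS.isCompact hP s N).2))
  have hreg := sum_pairing_le (G := G) (h := h) hS.isCompact hP s hxs N
  rw [← hX, hR2] at hreg
  -- The step balances the two regret terms: after division by h, the initial divergence R² becomes
  -- NB and the gradient terms become B U.
  have hhNB : h * (N * B) = R ^ 2 := by
    have : h * (N * B) = R ^ 2 * (N * √(2 / (N : ℝ)) ^ 2 / 2) := by
      rw [hh, hB, stepSize, bias]; field_simp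
    rw [this, hw2]; field_simp
  have hhB : ∀ x s, h ^ 2 * ‖G x s‖ ^ 2 / 2 = h * (B * gradSq G M x s) := fun x s => by
    rw [hh, hB, stepSize, bias, gradSq]; field_simp
  have hsum : ∑ k ∈ Finset.range N, pairing (G (X k) (s k)) (X k - xs) ≤
      N * B + ∑ k ∈ Finset.range N, B * gradSq G M (X k) (s k) := by
    refine le_of_mul_le_mul_left ?_ hh0
    rw [mul_add, hhNB, Finset.mul_sum, Finset.mul_sum]
    simp only [hhB] at hreg
    linarith
  have hgap : ∀ k, objective P F (X k) - objective P F xs ≤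
      pairing (G (X k) (s k)) (X k - xs) + noise P G xs (X k) (s k) := fun k => by
    have h1 := hS.unbiased (X k) (hXQ k) xs hxs
    have h2 : pairing (∫ s, G (X k) s ∂P) (xs - X k) =
        - pairing (∫ s, G (X k) s ∂P) (X k - xs) := by
      simp only [pairing_sub_right]; ring
    rw [noise, pairing_sub_left]
    linarith
  have havg := mul_average_le hS.convexOn hN hXQ
  have h3 := Finset.sum_le_sum fun k (_ : k ∈ Finset.range N) => hgap k
  simp only [Finset.sum_sub_distrib, Finset.sum_add_distrib, Finset.sum_const, Finset.card_range,
    nsmul_eq_mul] at h3 ⊢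
  linarith

variable {μ : Measure Ω} [IsProbabilityMeasure μ] {ξ : ℕ → Ω → Ξ} {N : ℕ} {σ C₁ C₂ : ℝ}

omit [Fact (1 ≤ q)] [Fact (1 ≤ p)] in
lemma highProbBound_of_forall (hσ : 0 < σ)
    (h : ∀ X : ℕ → Vec p n, (∃ s : ℕ → Ξ, X = iterate Q d x₀ G
        (stepSize (proxRadius Q d xs x₀) M N) s) →
      objective P F (average X N) - objective P F xs ≤ C₁ * M / √(N : ℝ) *
        (proxRadius Q d xs x₀ + C₂ * setDiam Q * √(Real.log σ⁻¹))) :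
    HighProbBound μ ξ Q P F G d x₀ xs M N σ C₁ C₂ := by
  refine le_trans ?_ (measureReal_mono (s₁ := Set.univ) fun ω _ => h _ ⟨fun k => ξ k ω, rfl⟩)
  rw [probReal_univ]
  linarith

/-- The bound is trivial when the starting point is already the minimizer. -/
lemma highProbBound_of_proxRadius_eq_zero (hS : IsStochasticProgram Q P F G)
    (hP : IsProxFunction Q d x₀) (hxs : xs ∈ Q) (hM : 0 < M) (hN : 0 < N) (hσ : 0 < σ)
    (hC₁ : 0 < C₁) (hC₂ : 0 < C₂) (hR : proxRadius Q d xs x₀ = 0) :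
    HighProbBound μ ξ Q P F G d x₀ xs M N σ C₁ C₂ := by
  have h1 := half_sq_norm_le_bregman hP.strongConvexOn hxs hP.start_mem
    hP.differentiableWithinAt_start
  have h2 : bregman Q d xs x₀ ≤ 0 := Real.sqrt_eq_zero'.1 hR
  have h3 : xs = x₀ := by
    refine sub_eq_zero.1 (norm_eq_zero.1 (pow_eq_zero_iff two_ne_zero |>.1 ?_))
    nlinarith [sq_nonneg ‖xs - x₀‖]
  refine highProbBound_of_forall hσ ?_
  rintro X ⟨s, rfl⟩
  have h4 : average (iterate Q d x₀ G (stepSize (proxRadius Q d xs x₀) M N) s) N = xs := by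
    rw [hR, h3]
    simp only [stepSize, zero_div, zero_mul, average, iterate_eq_start hS.isCompact hP,
      Finset.sum_const, Finset.card_range]
    rw [← Nat.cast_smul_eq_nsmul ℝ, smul_smul, inv_mul_cancel₀ (by exact_mod_cast hN.ne'), one_smul]
  rw [h4, sub_self, hR]
  have := setDiam_nonneg hS.isCompact hxs
  positivity

/-- The bound from exponential moments of the two parts of the error, truncated to a good set. -/
lemma highProbBound_of_exp_moments [IsProbabilityMeasure P] [p.HolderConjugate q]
    (hξ : ∀ k, Measurable (ξ k)) (hind : iIndepFun ξ μ) (hlaw : ∀ k, μ.map (ξ k) = P)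
    (hS : IsStochasticProgram Q P F G) (hP : IsProxFunction Q d x₀) (hxs : xs ∈ Q) (hM : 0 < M)
    (hN : 0 < N) (hσ : 0 < σ) (hR : 0 < proxRadius Q d xs x₀) (hD : 0 < setDiam Q)
    {A : Set (Vec p n × Ξ)} (hA : MeasurableSet A) {l a b Λ π : ℝ} (hl : 0 < l) (hπ : 0 ≤ π)
    (hexp₁ : ∀ x ∈ Q, ∫⁻ s in {s | (x, s) ∈ A}, ENNReal.ofReal (Real.exp
      (2 * l * bias (proxRadius Q d xs x₀) M N * gradSq G M x s)) ∂P ≤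
      ENNReal.ofReal (Real.exp (a * (2 * l * bias (proxRadius Q d xs x₀) M N))))
    (hexp₂ : ∀ x ∈ Q, ∫⁻ s in {s | (x, s) ∈ A}, ENNReal.ofReal (Real.exp
      (2 * l * (M * setDiam Q) * (noise P G xs x s / (M * setDiam Q)))) ∂P ≤
      ENNReal.ofReal (Real.exp (b * (2 * l * (M * setDiam Q)) ^ 2)))
    (hbad : ∀ x ∈ Q, P {s | (x, s) ∉ A} ≤ ENNReal.ofReal π)
    (hprob : Real.exp (-Λ) + N * π ≤ σ)
    (hbound : bias (proxRadius Q d xs x₀) M N + (a * bias (proxRadius Q d xs x₀) M N +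
      2 * b * l * (M * setDiam Q) ^ 2 + Λ / (l * N)) ≤
      C₁ * M / √(N : ℝ) * (proxRadius Q d xs x₀ + C₂ * setDiam Q * √(Real.log σ⁻¹))) :
    HighProbBound μ ξ Q P F G d x₀ xs M N σ C₁ C₂ := by
  set R := proxRadius Q d xs x₀
  set B := bias R M N
  set S := M * setDiam Q with hSd
  have hS0 : 0 < S := by positivity
  have hN' : (0 : ℝ) < N := by exact_mod_cast hN
  set X : ℕ → Ω → Vec p n := fun k ω => iterate Q d x₀ G (stepSize R M N) (fun i => ξ i ω) k
    with hXdef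
  have hXQ : ∀ k ω, X k ω ∈ Q := fun k ω => (iterate_spec hS.isCompact hP _ k).1
  have hX : ∀ k, Measurable[past ξ k] (X k) := fun k =>
    @measurable_iterate p q _ n Q d x₀ Ω (past ξ k) Ξ G _ _ _ hS.isCompact hP hS.measurable_grad
      ξ k fun i hi => measurable_past hi
  have hX' : ∀ k, Measurable (X k) := fun k => (hX k).mono (past_le hξ k) le_rfl
  set Z : Vec p n × Ξ → ℝ := fun z => B * gradSq G M z.1 z.2 + noise P G xs z.1 z.2 with hZdef
  have hgm := measurable_gradSq (M := M) hS.measurable_grad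
  have hnm := measurable_noise (P := P) (xs := xs) hS.measurable_grad
  have hZ : Measurable Z := (hgm.const_mul B).add hnm
  -- The threshold for which the Chernoff exponent Nρ - lt equals -Λ.
  set t := N * (a * B + 2 * b * l * S ^ 2) + Λ / l with ht
  have hmain := measure_sum_ge_le hξ hind hlaw hX hZ hA (l := l)
    (ρ := (a * (2 * l * B) + b * (2 * l * S) ^ 2) / 2) (t := t) (π := ENNReal.ofReal π) hl.le
    (fun k ω => by
      -- Here l Z is the mean of 2lB·U and 2lS·(noise/S), which explains the doubled rates in
      -- `hexp₁` and `hexp₂`.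
      have h := setLIntegral_exp_half_add_le
        ((hgm.comp (measurable_prodMk_left (x := X k ω))).const_mul (2 * l * B))
        (((hnm.comp (measurable_prodMk_left (x := X k ω))).div_const S).const_mul (2 * l * S))
        (hexp₁ _ (hXQ k ω)) (hexp₂ _ (hXQ k ω))
      convert h using 5 with s
      simp only [hZdef, Function.comp_apply, Function.uncurry_apply_pair]
      field_simp)
    (fun k ω => hbad _ (hXQ k ω)) N
  have hexpo : N * ((a * (2 * l * B) + b * (2 * l * S) ^ 2) / 2) - l * t = -Λ := by
    rw [ht]; field_simp; ring
  rw [hexpo] at hmain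
  have hle : μ.real {ω | t ≤ ∑ k ∈ Finset.range N, Z (X k ω, ξ k ω)} ≤ σ := by
    refine ENNReal.toReal_le_of_le_ofReal hσ.le (hmain.trans ?_)
    rw [← ENNReal.ofReal_natCast, ← ENNReal.ofReal_mul hN'.le,
      ← ENNReal.ofReal_add (Real.exp_pos _).le (by positivity)]
    exact ENNReal.ofReal_le_ofReal hprob
  -- Measurability is needed only for this bad event: its complement lies in the event of
  -- `HighProbBound`, and monotonicity of the measure suffices.
  have hms : MeasurableSet {ω | t ≤ ∑ k ∈ Finset.range N, Z (X k ω, ξ k ω)} :=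
    measurableSet_le measurable_const
      (Finset.measurable_fun_sum _ fun k _ => hZ.comp ((hX' k).prodMk (hξ k)))
  have hcompl := probReal_compl_eq_one_sub (μ := μ) hms
  rw [HighProbBound]
  refine (by linarith : 1 - σ ≤ μ.real {ω | t ≤ ∑ k ∈ Finset.range N, Z (X k ω, ξ k ω)}ᶜ).trans
    (measureReal_mono ?_)
  intro ω hω
  have hω' : ∑ k ∈ Finset.range N, Z (X k ω, ξ k ω) < t := not_le.1 hω
  have hreg := mul_objective_average_sub_le hS hP hxs hM hN hR (fun k => ξ k ω)
    (X := fun k => X k ω) rfl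
  refine le_trans ?_ hbound
  refine le_of_mul_le_mul_left ?_ hN'
  have e : N * (B + (a * B + 2 * b * l * S ^ 2 + Λ / (l * N))) = N * B + t := by
    rw [ht]; field_simp
  rw [e]
  exact hreg.trans (add_le_add_right hω'.le _)

end Assembly

/-! ### Choice of parameters under each tail condition. -/

section Cases

/-- The Chernoff parameter is a minimum of two constraints; this splits the cost Λ/(lN) into one
term for each. -/
lemma div_min_le {a b x : ℝ} (ha : 0 < a) (hb : 0 < b) (hx : 0 ≤ x) :
    x / min a b ≤ x / a + x / b := by
  rcases min_choice a b with h | h <;> rw [h]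
  · exact le_add_of_nonneg_right (by positivity)
  · exact le_add_of_nonneg_left (by positivity)

lemma log_le_two_mul_sqrt {x : ℝ} (hx : 0 < x) : Real.log x ≤ 2 * √x := by
  have h := Real.log_le_sub_one_of_pos (Real.sqrt_pos.2 hx)
  rw [Real.log_sqrt hx.le] at h
  linarith

/-- Controls the exponential at the truncation level. If L ≥ 1 then ηL ≤ (log N)/2; otherwise η ≤
1/2 and √e ≤ 2. -/
lemma exp_le_two_mul_sqrt {x η α L N : ℝ} (hN : 1 ≤ N) (hα : 2 < α) (hη0 : 0 ≤ η)
    (hη : η * (α - 1) ≤ 1 / 2) (hL : L ≤ (α - 1) * Real.log N) (hx : x ≤ η * max L 1) :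
    Real.exp x ≤ 2 * √N := by
  have hs : 1 ≤ √N := Real.one_le_sqrt.2 hN
  rcases le_total L 1 with h | h
  · rw [max_eq_right h] at hx
    have h1 : Real.exp x ≤ Real.exp (1 / 2) := Real.exp_le_exp.2 (by nlinarith)
    have h2 : Real.exp (1 / 2) ^ 2 = Real.exp 1 := by
      rw [← Real.exp_nat_mul]; norm_num
    have h3 := Real.exp_one_lt_d9
    nlinarith [Real.exp_pos (1 / 2)]
  · rw [max_eq_left h] at hx
    have h1 : x ≤ Real.log (√N) := by
      rw [Real.log_sqrt (by linarith)]
      nlinarith [Real.log_nonneg hN, mul_le_mul_of_nonneg_left hL hη0]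
    have h2 := Real.exp_le_exp.2 h1
    rw [Real.exp_log (by linarith)] at h2
    linarith

/-- The probability that one of `N` samples leaves the good set is absorbed by `σ = exp (-L)`. -/
lemma exp_add_mul_rpow_le {α L N : ℝ} (hα : 2 < α) (hL0 : 0 < L) (hN : 1 ≤ N)
    (hL : L ≤ (α - 1) * Real.log N) :
    Real.exp (-(2 * L)) + N * (1 + 2 * N / min L 1) ^ (-α) ≤ Real.exp (-L) := by
  set r := min L 1 with hr
  have hr0 : 0 < r := lt_min hL0 one_pos
  have hr1 : r ≤ 1 := min_le_right _ _
  have hN0 : 0 < N := by linarith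
  have h1 : (1 + 2 * N / r) ^ (-α) ≤ (2 * N / r) ^ (-α) :=
    Real.rpow_le_rpow_of_nonpos (by positivity) (by linarith) (by linarith)
  have h2 : (2 * N / r) ^ (-α) = N ^ (-α) * (r / 2) ^ α := by
    rw [show 2 * N / r = N * (r / 2)⁻¹ by field_simp, Real.mul_rpow hN0.le (by positivity),
      Real.rpow_neg (x := (r / 2)⁻¹) (by positivity), Real.inv_rpow (by positivity), inv_inv]
  have h3 : (r / 2) ^ α ≤ r / 2 := by
    have h := Real.rpow_le_rpow_of_exponent_ge (x := r / 2) (by positivity) (by linarith)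
      (by linarith : (1 : ℝ) ≤ α)
    rwa [Real.rpow_one] at h
  have h4 : N * N ^ (-α) ≤ Real.exp (-L) := by
    have h : N * N ^ (-α) = Real.exp ((1 - α) * Real.log N) := by
      rw [← Real.rpow_one_add' hN0.le (by linarith), Real.rpow_def_of_pos hN0, mul_comm,
        sub_eq_add_neg]
    rw [h]
    exact Real.exp_le_exp.2 (by linarith)
  have h5 : Real.exp (-L) * (1 + r) ≤ 1 := by
    have h6 := Real.add_one_le_exp L
    have h7 : Real.exp (-L) * Real.exp L = 1 := by rw [← Real.exp_add]; simp
    have h8 : r ≤ L := min_le_left _ _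
    nlinarith [Real.exp_pos (-L)]
  have h6 : Real.exp (-(2 * L)) = Real.exp (-L) * Real.exp (-L) := by
    rw [← Real.exp_add]; congr 1; ring
  have h7 : N * (1 + 2 * N / r) ^ (-α) ≤ Real.exp (-L) * (r / 2) := by
    calc N * (1 + 2 * N / r) ^ (-α) ≤ N * (N ^ (-α) * (r / 2) ^ α) := by
          rw [← h2]; exact mul_le_mul_of_nonneg_left h1 hN0.le
      _ = N * N ^ (-α) * (r / 2) ^ α := by ring
      _ ≤ Real.exp (-L) * (r / 2) := mul_le_mul h4 h3 (by positivity) (Real.exp_pos _).le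
  -- With σ = exp(-L), what remains is σ² + σr/2 ≤ σ. The factor r = min(L, 1) in the truncation
  -- level is needed when σ is near 1, where σ - σ² is only of order L.
  have h8 : Real.exp (-L) ≤ 1 - r / 2 := by
    have h9 : (1 : ℝ) ≤ (1 - r / 2) * (1 + r) := by nlinarith
    exact le_of_mul_le_mul_right (h5.trans h9) (by linarith)
  rw [h6]
  nlinarith [mul_le_mul_of_nonneg_left h8 (Real.exp_pos (-L)).le]

variable {p q : ℝ≥0∞} [Fact (1 ≤ p)] [Fact (1 ≤ q)] [p.HolderConjugate q] {n : ℕ}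
  {Q : Set (Vec p n)} {Ξ Ω : Type*} [MeasurableSpace Ξ] [MeasurableSpace Ω]
  {P : Measure Ξ} [IsProbabilityMeasure P] {μ : Measure Ω} [IsProbabilityMeasure μ]
  {ξ : ℕ → Ω → Ξ} {F : Vec p n → Ξ → ℝ} {G : Vec p n → Ξ → Vec q n}
  {d : Vec p n → ℝ} {x₀ xs : Vec p n} {M σ : ℝ} {N : ℕ}

omit [Fact (1 ≤ p)] [p.HolderConjugate q] [IsProbabilityMeasure P] in
lemma measurable_gradSq_left (hG : Measurable (Function.uncurry G)) (x : Vec p n) :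
    Measurable (gradSq G M x) :=
  (measurable_gradSq hG).of_uncurry_left

omit [Fact (1 ≤ p)] [p.HolderConjugate q] [IsProbabilityMeasure P] in
lemma SubGaussianGrad.integrable_exp (hG : Measurable (Function.uncurry G))
    (h : SubGaussianGrad Q P G M) {x : Vec p n} (hx : x ∈ Q) :
    Integrable (fun s => Real.exp (gradSq G M x s)) P ∧
      ∫ s, Real.exp (gradSq G M x s) ∂P ≤ Real.exp 1 :=
  integrable_of_lintegral_ofReal_le (measurable_gradSq_left hG x).exp
    (fun _ => (Real.exp_pos _).le) (Real.exp_pos _).le (h x hx)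

omit [Fact (1 ≤ p)] [p.HolderConjugate q] [IsProbabilityMeasure P] in
lemma SubGaussianGrad.integrable_gradSq (hG : Measurable (Function.uncurry G))
    (h : SubGaussianGrad Q P G M) {x : Vec p n} (hx : x ∈ Q) :
    Integrable (gradSq G M x) P ∧ ∫ s, gradSq G M x s ∂P ≤ 1 := by
  obtain ⟨h1, h2⟩ := h.integrable_exp hG hx
  have hpt : ∀ s, gradSq G M x s ≤ Real.exp (-1) * Real.exp (gradSq G M x s) := fun s => by
    rw [← Real.exp_add]
    linarith [Real.add_one_le_exp (-1 + gradSq G M x s)]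
  have hi : Integrable (gradSq G M x) P :=
    (h1.const_mul (Real.exp (-1))).mono' (measurable_gradSq_left hG x).aestronglyMeasurable
      (.of_forall fun s => by
        rw [Real.norm_of_nonneg (gradSq_nonneg x s)]; exact hpt s)
  refine ⟨hi, (integral_mono hi (h1.const_mul _) hpt).trans ?_⟩
  rw [integral_const_mul]
  refine (mul_le_mul_of_nonneg_left h2 (Real.exp_pos _).le).trans_eq ?_
  rw [← Real.exp_add]; simp

omit [Fact (1 ≤ p)] [p.HolderConjugate q] in
lemma BoundedGrad.subGaussianGrad (hM : 0 < M) (h : BoundedGrad Q P G M) :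
    SubGaussianGrad Q P G M := by
  intro x hx
  calc ∫⁻ s, ENNReal.ofReal (Real.exp (‖G x s‖ ^ 2 / M ^ 2)) ∂P
      ≤ ∫⁻ s, ENNReal.ofReal (Real.exp 1) ∂P := by
        refine lintegral_mono_ae ((h x hx).mono fun s hs => ?_)
        refine ENNReal.ofReal_le_ofReal (Real.exp_le_exp.2 ((div_le_one (by positivity)).2 ?_))
        exact pow_le_pow_left₀ (norm_nonneg _) hs 2
    _ = _ := by simp

/-- If the gradient has second moment at most `M²`, then the bound is deterministic for
`N ≤ log σ⁻¹`. -/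
lemma highProbBound_of_le_log (hS : IsStochasticProgram Q P F G) (hP : IsProxFunction Q d x₀)
    (hxs : xs ∈ Q) (hM : 0 < M) (hN : 0 < N) (hσ : 0 < σ) (hL : N ≤ Real.log σ⁻¹)
    (hU : ∀ x ∈ Q, Integrable (gradSq G M x) P ∧ ∫ s, gradSq G M x s ∂P ≤ 1) :
    HighProbBound μ ξ Q P F G d x₀ xs M N σ 3 2 := by
  refine highProbBound_of_forall hσ ?_
  rintro X ⟨s, rfl⟩
  have hx := average_mem hS.convex hN fun k =>
    (iterate_spec (G := G) (h := stepSize (proxRadius Q d xs x₀) M N) hS.isCompact hP s k).1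
  obtain ⟨h1, h2⟩ := hU _ hx
  refine (objective_sub_le hM (hS.integrable_grad _ hx) h1 h2 hS hx hxs).trans ?_
  have hN' : (0 : ℝ) < √(N : ℝ) := Real.sqrt_pos.2 (by exact_mod_cast hN)
  have h3 : √(N : ℝ) ≤ √(Real.log σ⁻¹) := Real.sqrt_le_sqrt hL
  have hD := setDiam_nonneg hS.isCompact hxs
  have hR : 0 ≤ proxRadius Q d xs x₀ := Real.sqrt_nonneg _
  rw [div_mul_eq_mul_div, le_div_iff₀ hN']
  have h4 : M * setDiam Q * √(N : ℝ) ≤ M * setDiam Q * √(Real.log σ⁻¹) :=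
    mul_le_mul_of_nonneg_left h3 (by positivity)
  have h5 : 0 ≤ M * setDiam Q * √(Real.log σ⁻¹) := by positivity
  have h6 : 0 ≤ M * proxRadius Q d xs x₀ := by positivity
  linarith

lemma setDiam_pos_of_proxRadius_pos (hQ : IsCompact Q) (hP : IsProxFunction Q d x₀) (hxs : xs ∈ Q)
    (hR : 0 < proxRadius Q d xs x₀) : 0 < setDiam Q := by
  refine lt_of_lt_of_le (norm_pos_iff.2 (sub_ne_zero.2 ?_)) (norm_sub_le_setDiam hQ hxs hP.start_mem)
  rintro rfl
  simp [proxRadius] at hR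

lemma abs_noise_div_le (hS : IsStochasticProgram Q P F G) (hxs : xs ∈ Q) (hM : 0 < M)
    (hD : 0 < setDiam Q) {x : Vec p n} (hx : x ∈ Q)
    (hU : Integrable (gradSq G M x) P ∧ ∫ s, gradSq G M x s ∂P ≤ 1) (s : Ξ) :
    |noise P G xs x s / (M * setDiam Q)| ≤ 1 + √(gradSq G M x s) := by
  have hS0 : 0 < M * setDiam Q := by positivity
  rw [abs_div, abs_of_pos hS0, div_le_iff₀ hS0, mul_comm]
  exact abs_noise_le hM (hS.integrable_grad x hx) hU.1 hU.2 hS.isCompact hx hxs s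

omit [p.HolderConjugate q] in
lemma integral_noise_div (hS : IsStochasticProgram Q P F G) {x : Vec p n} (hx : x ∈ Q) (c : ℝ) :
    Integrable (fun s => noise P G xs x s / c) P ∧ ∫ s, noise P G xs x s / c ∂P = 0 := by
  obtain ⟨h1, h2⟩ := integral_noise (xs := xs) (hS.integrable_grad x hx)
  exact ⟨h1.div_const c, by rw [integral_div, h2, zero_div]⟩

variable (hξ : ∀ k, Measurable (ξ k)) (hind : iIndepFun ξ μ) (hlaw : ∀ k, μ.map (ξ k) = P)
  (hS : IsStochasticProgram Q P F G) (hP : IsProxFunction Q d x₀) (hxs : xs ∈ Q)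
  (hM : 0 < M) (hN : 0 < N) (hσ : 0 < σ) (hσ1 : σ < 1)
include hξ hind hlaw hS hP hxs hM hN hσ hσ1

/-- The range N ≤ log σ⁻¹ is handled deterministically, so the lemma also serves bounded gradients,
where N and σ are unrelated. -/
lemma highProbBound_of_subGaussianGrad (hG : SubGaussianGrad Q P G M) :
    HighProbBound μ ξ Q P F G d x₀ xs M N σ 3 2 := by
  have hGm := hS.measurable_grad
  rcases le_or_gt (N : ℝ) (Real.log σ⁻¹) with hL | hL
  · exact highProbBound_of_le_log hS hP hxs hM hN hσ hL fun x hx => hG.integrable_gradSq hGm hx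
  rcases (Real.sqrt_nonneg (bregman Q d xs x₀)).eq_or_lt with hR | hR
  · exact highProbBound_of_proxRadius_eq_zero hS hP hxs hM hN hσ (by norm_num) (by norm_num) hR.symm
  change 0 < proxRadius Q d xs x₀ at hR
  have hD := setDiam_pos_of_proxRadius_pos hS.isCompact hP hxs hR
  set L := Real.log σ⁻¹ with hLdef
  have hL0 : 0 < L := Real.log_pos (one_lt_inv₀ hσ |>.2 hσ1)
  have hN' : (0 : ℝ) < N := by exact_mod_cast hN
  set B := bias (proxRadius Q d xs x₀) M N with hB
  have hB0 : 0 < B := by rw [hB, bias]; positivity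
  set S := M * setDiam Q with hSd
  have hS0 : 0 < S := by positivity
  set w := √(L / N) with hw
  have hw0 : 0 < w := Real.sqrt_pos.2 (by positivity)
  have hw2 : w ^ 2 = L / N := Real.sq_sqrt (by positivity)
  -- The first entry keeps the order 2lB of the moment of U at most 1; the second balances 8lS²
  -- against w²/l.
  set l := min (1 / (2 * B)) (w / (3 * S)) with hl
  have hl0 : 0 < l := lt_min (by positivity) (by positivity)
  have hl1 : l ≤ 1 / (2 * B) := min_le_left _ _
  have hl2 : l ≤ w / (3 * S) := min_le_right _ _
  refine highProbBound_of_exp_moments hξ hind hlaw hS hP hxs hM hN hσ hR hD (A := Set.univ) .univ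
    (l := l) (a := 1) (b := 4) (Λ := L) (π := 0) hl0 le_rfl ?_ ?_ (by simp) ?_ ?_
  · intro x hx
    rw [one_mul]
    obtain ⟨h1, h2⟩ := hG.integrable_exp hGm hx
    refine lintegral_exp_mul_le h1 h2 (by positivity) ?_
    rw [le_div_iff₀ (by positivity)] at hl1
    linarith
  · intro x hx
    obtain ⟨h1, h2⟩ := hG.integrable_exp hGm hx
    obtain ⟨h3, h4⟩ := integral_noise_div (xs := xs) hS hx S
    exact lintegral_exp_mul_centered_le h1 h2 (fun s => gradSq_nonneg x s) h3 h4
      (abs_noise_div_le hS hxs hM hD hx (hG.integrable_gradSq hGm hx))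
      (by positivity)
  · rw [mul_zero, add_zero, hLdef, Real.log_inv, neg_neg, Real.exp_log hσ]
  · have e1 : L / (l * N) = w ^ 2 / l := by rw [hw2]; field_simp
    have h1 : w ^ 2 / l ≤ 2 * B * w ^ 2 + 3 * S * w := by
      refine (div_min_le (by positivity) (by positivity) (by positivity)).trans_eq ?_
      field_simp
    have h2 : l * S ^ 2 ≤ S * w / 3 := by
      refine (mul_le_mul_of_nonneg_right hl2 (sq_nonneg S)).trans_eq ?_
      field_simp
    have hw1 : w ^ 2 ≤ 1 := by rw [hw2]; exact (div_le_one hN').2 hL.le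
    have h3 : B * w ^ 2 ≤ B := mul_le_of_le_one_right hB0.le hw1
    rw [e1]
    have e2 : 3 * M / √(N : ℝ) * (proxRadius Q d xs x₀ + 2 * setDiam Q * √L) =
        3 * (M / √(N : ℝ) * proxRadius Q d xs x₀) + 6 * (S * w) := by
      rw [hw, Real.sqrt_div hL0.le, hSd]; ring
    -- The error totals at most 4B + (8/3 + 3)Sw. Since 4B = 2√2·MR/√N and 8/3 + 3 < 6, the
    -- constants 3 and 2 suffice.
    have e3 : 4 * B ≤ 3 * (M / √(N : ℝ) * proxRadius Q d xs x₀) := by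
      rw [hB, bias_eq]
      have h2 : √2 ≤ 3 / 2 := Real.sqrt_le_iff.2 ⟨by norm_num, by norm_num⟩
      have : 0 ≤ M / √(N : ℝ) * proxRadius Q d xs x₀ := by positivity
      nlinarith
    rw [e2]
    have : 0 < S * w := by positivity
    linarith

set_option maxHeartbeats 600000 in
-- On {U ≤ τ} the Taylor remainders carry a factor of order √N from `exp_le_two_mul_sqrt`. It is
-- beaten by w²√N = L/√N ≤ 2(α - 1), which follows from L ≤ (α - 1) log N.
lemma highProbBound_of_polynomialTailGrad {α : ℝ} (hα : 2 < α) (hG : PolynomialTailGrad Q P G M α)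
    (hσN : σ ^ (-1 / (α - 1)) ≤ (N : ℝ)) :
    HighProbBound μ ξ Q P F G d x₀ xs M N σ
      (10 + 256 * (1 + 2 / (α - 2)) * (α - 1)) 2 := by
  have hGm := hS.measurable_grad
  have hα2 : 0 < α - 2 := by linarith
  have hα1 : 0 < α - 1 := by linarith
  set v := 2 / (α - 2) with hv
  have hv0 : 0 < v := by positivity
  rcases (Real.sqrt_nonneg (bregman Q d xs x₀)).eq_or_lt with hR | hR
  · exact highProbBound_of_proxRadius_eq_zero hS hP hxs hM hN hσ (by positivity) (by norm_num)
      hR.symm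
  change 0 < proxRadius Q d xs x₀ at hR
  have hD := setDiam_pos_of_proxRadius_pos hS.isCompact hP hxs hR
  set L := Real.log σ⁻¹ with hLdef
  have hL0 : 0 < L := Real.log_pos (one_lt_inv₀ hσ |>.2 hσ1)
  have hσL : Real.exp (-L) = σ := by rw [hLdef, Real.log_inv, neg_neg, Real.exp_log hσ]
  have hN' : (0 : ℝ) < N := by exact_mod_cast hN
  have hN1 : (1 : ℝ) ≤ N := by exact_mod_cast hN
  have hLN : L ≤ (α - 1) * Real.log N := by
    have h := Real.log_le_log (by positivity) hσN
    rw [Real.log_rpow hσ] at h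
    have e : (α - 1) * (-1 / (α - 1) * Real.log σ) = L := by
      rw [hLdef, Real.log_inv]; field_simp
    rw [← e]
    exact mul_le_mul_of_nonneg_left h hα1.le
  set B := bias (proxRadius Q d xs x₀) M N with hB
  have hB0 : 0 < B := by rw [hB, bias]; positivity
  set S := M * setDiam Q with hSd
  have hS0 : 0 < S := by positivity
  set w := √(L / N) with hw
  have hw0 : 0 < w := Real.sqrt_pos.2 (by positivity)
  have hw2 : w ^ 2 = L / N := Real.sq_sqrt (by positivity)
  have hw3 : w ^ 2 * √(N : ℝ) ≤ 2 * (α - 1) := by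
    have h1 := mul_le_mul_of_nonneg_left (log_le_two_mul_sqrt hN') hα1.le
    have h2 : w ^ 2 * √(N : ℝ) = L / √(N : ℝ) := by
      rw [hw2]
      nth_rw 1 [← Real.sq_sqrt hN'.le]
      field_simp
    rw [h2, div_le_iff₀ (Real.sqrt_pos.2 hN')]
    linarith
  -- A scale small enough that both Taylor remainders below cost at most one extra θ or β². The
  -- final constant is 10 + 2/κ.
  obtain ⟨κ, hκ⟩ : ∃ κ, κ = 1 / (128 * (1 + v) * (α - 1)) := ⟨_, rfl⟩
  have hκ0 : 0 < κ := by rw [hκ]; positivity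
  have hκ1 : κ * (1 + v) * (α - 1) = 1 / 128 := by rw [hκ]; field_simp
  have hκv : κ * (α - 1) ≤ 1 / 128 := by
    rw [← hκ1, mul_assoc]
    exact mul_le_mul_of_nonneg_left (le_mul_of_one_le_left hα1.le (by linarith)) hκ0.le
  have hκ2 : κ ≤ 1 / 128 := (le_mul_of_one_le_right hκ0.le (by linarith)).trans hκv
  have hC : 10 + 256 * (1 + v) * (α - 1) = 10 + 2 / κ := by rw [hκ]; field_simp; ring
  rw [hC]
  set l := min (κ * w ^ 2 / B) (κ * w / S) with hl
  have hl0 : 0 < l := lt_min (by positivity) (by positivity)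
  have hl1 : l * B ≤ κ * w ^ 2 := (le_div_iff₀ hB0).1 (min_le_left _ _)
  have hl2 : l * S ≤ κ * w := (le_div_iff₀ hS0).1 (min_le_right _ _)
  -- Since min(L, 1)·max(L, 1) = L, this gives w²τ = 2 max(L, 1), so the truncated exponents are at
  -- most 8κ max(L, 1).
  set τ := 2 * N / min L 1 with hτ
  have hm0 : 0 < min L 1 := lt_min hL0 one_pos
  have hm1 : min L 1 * max L 1 = L := by rw [min_mul_max, mul_one]
  have hmx : 1 ≤ max L 1 := le_max_right _ _
  have hτ1 : 1 ≤ τ := by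
    rw [hτ, le_div_iff₀ hm0]
    linarith [min_le_right L 1]
  have hwτ : w ^ 2 * τ = 2 * max L 1 := by
    rw [hw2, hτ]
    nth_rw 1 [← hm1]
    field_simp
  have hwτ' : w * √τ ≤ 2 * max L 1 := by
    refine le_of_sq_le_sq ?_ (by linarith)
    rw [mul_pow, Real.sq_sqrt (zero_le_one.trans hτ1), hwτ]
    nlinarith
  have hη : 8 * κ * (α - 1) ≤ 1 / 2 := by linarith
  have hexp : ∀ y ≤ 8 * κ * max L 1, Real.exp y ≤ 2 * √(N : ℝ) := fun y hy =>
    exp_le_two_mul_sqrt hN1 hα (by positivity) hη hLN hy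
  have hmom : ∀ x ∈ Q, _ := fun x hx => integrable_and_integral_le_one_of_tail hα
    (measurable_gradSq_left hGm x) (fun s => gradSq_nonneg (M := M) x s) (hG x hx)
  have hmom2 : ∀ x ∈ Q, _ := fun x hx => integrable_sq_and_integral_sq_le_of_tail hα
    (measurable_gradSq_left hGm x) (fun s => gradSq_nonneg (M := M) x s) (hG x hx)
  have hsN : 1 ≤ √(N : ℝ) := Real.one_le_sqrt.2 hN1
  -- Here a = 1 + 1 and b = 4 + 1 include the Taylor remainders, and Λ = 2L leaves room in σ for the
  -- truncation.
  refine highProbBound_of_exp_moments hξ hind hlaw hS hP hxs hM hN hσ hR hD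
    (A := {z | gradSq G M z.1 z.2 ≤ τ})
    (measurableSet_le (measurable_gradSq hGm) measurable_const)
    (l := l) (a := 2) (b := 5) (Λ := 2 * L) (π := (1 + τ) ^ (-α)) hl0 (by positivity)
    ?_ ?_ ?_ ?_ ?_
  · intro x hx
    set θ := 2 * l * B with hθ
    have hθ0 : 0 < θ := by positivity
    have hθ1 : θ ≤ 2 * κ * w ^ 2 := by linarith
    refine (setLIntegral_exp_mul_le (measurable_gradSq_left hGm x) (fun s => gradSq_nonneg x s)
      (hmom x hx).1 (hmom x hx).2 (hmom2 x hx).1 (hmom2 x hx).2 hθ0.le).trans ?_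
    refine ENNReal.ofReal_le_ofReal (Real.exp_le_exp.2 ?_)
    have h1 : Real.exp (θ * τ) ≤ 2 * √(N : ℝ) := by
      refine hexp _ ?_
      calc θ * τ ≤ 2 * κ * w ^ 2 * τ := mul_le_mul_of_nonneg_right hθ1 (by positivity)
        _ = 4 * κ * max L 1 := by rw [mul_assoc, hwτ]; ring
        _ ≤ 8 * κ * max L 1 := by gcongr; norm_num
    have h2 : θ * (v * (1 + Real.exp (θ * τ))) ≤ 1 := by
      calc θ * (v * (1 + Real.exp (θ * τ)))
          ≤ (2 * κ * w ^ 2) * ((1 + v) * (3 * √(N : ℝ))) := by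
            gcongr
            · linarith
            · linarith
        _ = 6 * κ * (1 + v) * (w ^ 2 * √(N : ℝ)) := by ring
        _ ≤ 6 * κ * (1 + v) * (2 * (α - 1)) := by gcongr
        _ ≤ 1 := by linarith
    have h3 := mul_le_mul_of_nonneg_left h2 hθ0.le
    linarith [show θ ^ 2 * (v * (1 + Real.exp (θ * τ))) = θ * (θ * (v * (1 + Real.exp (θ * τ))))
      by ring]
  · intro x hx
    set β := 2 * l * S with hβ
    have hβ0 : 0 < β := by positivity
    have hβ1 : β ≤ 2 * κ * w := by linarith
    obtain ⟨h3, h4⟩ := integral_noise_div (xs := xs) hS hx S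
    refine (setLIntegral_exp_mul_centered_le (measurable_gradSq_left hGm x)
      (fun s => gradSq_nonneg x s) (hmom x hx).1 (hmom x hx).2 (hmom2 x hx).1 (hmom2 x hx).2 h3 h4
      (abs_noise_div_le hS hxs hM hD hx (hmom x hx)) hβ0.le hτ1).trans ?_
    refine ENNReal.ofReal_le_ofReal (Real.exp_le_exp.2 ?_)
    have h1 : Real.exp (β * (2 * √τ)) ≤ 2 * √(N : ℝ) := by
      refine hexp _ ?_
      calc β * (2 * √τ) ≤ 2 * κ * w * (2 * √τ) := mul_le_mul_of_nonneg_right hβ1 (by positivity)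
        _ = 4 * κ * (w * √τ) := by ring
        _ ≤ 4 * κ * (2 * max L 1) := mul_le_mul_of_nonneg_left hwτ' (by positivity)
        _ = 8 * κ * max L 1 := by ring
    have h2 : β ^ 2 * ((8 + 8 * v) * Real.exp (β * (2 * √τ))) ≤ 1 := by
      calc β ^ 2 * ((8 + 8 * v) * Real.exp (β * (2 * √τ)))
          ≤ (2 * κ * w) ^ 2 * ((8 + 8 * v) * (2 * √(N : ℝ))) := by gcongr
        _ = 64 * κ ^ 2 * (1 + v) * (w ^ 2 * √(N : ℝ)) := by ring
        _ ≤ 64 * κ ^ 2 * (1 + v) * (2 * (α - 1)) := by gcongr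
        _ = 128 * κ * (κ * (1 + v) * (α - 1)) := by ring
        _ ≤ 1 := by rw [hκ1]; linarith
    have h5 := mul_le_mul_of_nonneg_left h2 (sq_nonneg β)
    linarith [show β ^ 4 * ((8 + 8 * v) * Real.exp (β * (2 * √τ))) =
      β ^ 2 * (β ^ 2 * ((8 + 8 * v) * Real.exp (β * (2 * √τ)))) by ring]
  · intro x hx
    refine le_trans (measure_mono fun s hs => ?_) (hG x hx τ (zero_le_one.trans hτ1))
    simp only [Set.mem_ofPred_eq, not_le, gradSq] at hs ⊢
    exact hs.le
  · rw [← hσL]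
    exact exp_add_mul_rpow_le hα hL0 hN1 hLN
  · have e1 : 2 * L / (l * N) = 2 * w ^ 2 / l := by rw [hw2]; field_simp
    have h1 : 2 * w ^ 2 / l ≤ 2 / κ * B + 2 / κ * (S * w) := by
      refine (div_min_le (by positivity) (by positivity) (by positivity)).trans_eq ?_
      field_simp
    have hSw : 0 < S * w := by positivity
    have h2 : l * S ^ 2 ≤ S * w := by
      have : l * S ^ 2 = (l * S) * S := by ring
      rw [this]
      refine (mul_le_mul_of_nonneg_right hl2 hS0.le).trans ?_
      rw [mul_assoc, mul_comm w S]
      exact mul_le_of_le_one_left hSw.le (by linarith)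
    rw [e1]
    have hb0 : 0 < M / √(N : ℝ) * proxRadius Q d xs x₀ := by positivity
    have e2 : (10 + 2 / κ) * M / √(N : ℝ) * (proxRadius Q d xs x₀ + 2 * setDiam Q * √L) =
        (10 + 2 / κ) * (M / √(N : ℝ) * proxRadius Q d xs x₀) + (20 + 4 / κ) * (S * w) := by
      rw [hw, Real.sqrt_div hL0.le, hSd]; ring
    have e3 : B ≤ M / √(N : ℝ) * proxRadius Q d xs x₀ := by
      rw [hB, bias_eq]
      have h2 : √2 ≤ 2 := Real.sqrt_le_iff.2 ⟨by norm_num, by norm_num⟩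
      nlinarith
    have hκi : 0 < 2 / κ := by positivity
    have e4 : 4 / κ = 2 * (2 / κ) := by ring
    rw [e2, e4]
    have h3 := mul_le_mul_of_nonneg_left e3 hκi.le
    have h4 := mul_pos hκi hSw
    linarith

end Cases

end MirrorDescent

/-! ### The theorem. -/

theorem mainTheorem1 :
    ∃ (C₁ C₂ : ℝ) (C₃ : ℝ → ℝ), 0 < C₁ ∧ C₁ ≤ 3 ∧ 0 < C₂ ∧ C₂ ≤ 3 ∧ (∀ α : ℝ, 2 < α → 0 < C₃ α) ∧
      ∀ (n : ℕ) (p q : ℝ≥0∞) [Fact (1 ≤ p)] [Fact (1 ≤ q)] [p.HolderConjugate q], p ≤ 2 →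
      ∀ {Ξ Ω : Type*} [MeasurableSpace Ξ] [MeasurableSpace Ω]
        (P : Measure Ξ) [IsProbabilityMeasure P] (μ : Measure Ω) [IsProbabilityMeasure μ]
        (ξ : ℕ → Ω → Ξ), (∀ k, Measurable (ξ k)) → iIndepFun ξ μ → (∀ k, μ.map (ξ k) = P) →
      ∀ (Q : Set (MirrorDescent.Vec p n)) (F : MirrorDescent.Vec p n → Ξ → ℝ)
        (G : MirrorDescent.Vec p n → Ξ → MirrorDescent.Vec q n),
        MirrorDescent.IsStochasticProgram Q P F G →
      ∀ (d : MirrorDescent.Vec p n → ℝ) (x₀ xs : MirrorDescent.Vec p n),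
        MirrorDescent.IsProxFunction Q d x₀ →
        xs ∈ Q → IsMinOn (MirrorDescent.objective P F) Q xs →
      ∀ (M σ : ℝ) (N : ℕ), 0 < M → 0 < σ → σ < 1 → 0 < N →
        (MirrorDescent.BoundedGrad Q P G M →
          MirrorDescent.HighProbBound μ ξ Q P F G d x₀ xs M N σ C₁ C₂) ∧
        (MirrorDescent.SubGaussianGrad Q P G M → Real.log σ⁻¹ ≤ N →
          MirrorDescent.HighProbBound μ ξ Q P F G d x₀ xs M N σ C₁ C₂) ∧
        (∀ α : ℝ, 2 < α → MirrorDescent.PolynomialTailGrad Q P G M α →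
          σ ^ (-1 / (α - 1)) ≤ (N : ℝ) →
          MirrorDescent.HighProbBound μ ξ Q P F G d x₀ xs M N σ (C₃ α) C₂) := by
  refine ⟨3, 2, fun α => 10 + 256 * (1 + 2 / (α - 2)) * (α - 1),
    by norm_num, le_rfl, by norm_num, by norm_num, fun α hα => ?_, ?_⟩
  · have h1 : 0 < α - 2 := by linarith
    have h2 : 0 < α - 1 := by linarith
    positivity
  · intro n p q _ _ _ _ Ξ Ω _ _ P _ μ _ ξ hξ hind hlaw Q F G hS d x₀ xs hP hxs _ M σ N hM hσ hσ1 hN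
    refine ⟨fun h => ?_, fun h _ => ?_, fun α hα h hσN => ?_⟩
    · exact MirrorDescent.highProbBound_of_subGaussianGrad hξ hind hlaw hS hP hxs hM hN hσ hσ1
        (h.subGaussianGrad hM)
    · exact MirrorDescent.highProbBound_of_subGaussianGrad hξ hind hlaw hS hP hxs hM hN hσ hσ1 h
    · exact MirrorDescent.highProbBound_of_polynomialTailGrad hξ hind hlaw hS hP hxs hM hN hσ hσ1
        hα h hσN
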